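/- There is a polynomial-time algorithm for the following problem: given $n, k \ge 0$, a quadratic polynomial $q$ and linear polynomials $\ell_1, \dots, \ell_k$ over $\mathrm{GF}(2)$ in the variables $x_1, \dots, x_n$, determine the number of points $x \in \mathrm{GF}(2)^n$ that satisfy $q(x) = 0$, $\ell_1(x) = 0, \dots, \ell_k(x) = 0$ simultaneously. Here "quadratic" means of degree at most $2$ and "linear" means of degree at most $1$ (constant terms are allowed). The polynomials are given by the list of all their coefficients (up to degree $2$ for $q$ and up to degree $1$ for each $\ell_i$), the answer is written in binary, and polynomial time means that a single multi-stack Turing machine computes the answer in a number of steps bounded by a polynomial in the length of the input. -/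

import Mathlib

/-- An instance of the counting problem: a number `n` of variables, a quadratic polynomial `q`
and `k` linear polynomials `ℓ 0, …, ℓ (k - 1)` over GF(2) in these variables.  "Quadratic" means
degree at most two and "linear" means degree at most one (constant terms are allowed).
Both `n` and `k` are part of the instance. -/
structure QuadLinSystem where
  /-- number of variables -/
  n : ℕ
  /-- the quadratic polynomial -/
  q : MvPolynomial (Fin n) (ZMod 2)
  q_quadratic : q.totalDegree ≤ 2
  /-- number of linear polynomials -/
  k : ℕ
  /-- the linear polynomials -/
  ℓ : Fin k → MvPolynomial (Fin n) (ZMod 2)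
  ℓ_linear : ∀ i, (ℓ i).totalDegree ≤ 1

namespace QuadLinSystem

/-- The number of points of `GF(2)ⁿ` at which `q` and all the `ℓ i` vanish simultaneously. -/
noncomputable def numSolutions (I : QuadLinSystem) : ℕ :=
  Nat.card {x : Fin I.n → ZMod 2 //
    MvPolynomial.eval x I.q = 0 ∧ ∀ i, MvPolynomial.eval x (I.ℓ i) = 0}

/-- The coefficients of `x₀, …, xₙ₋₁` in `p`, followed by the constant coefficient. -/
noncomputable def affineRow {n : ℕ} (p : MvPolynomial (Fin n) (ZMod 2)) : List (ZMod 2) :=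
  List.ofFn (fun i => p.coeff (Finsupp.single i 1)) ++ [p.coeff 0]

/-- The coefficients of `xᵢ x₀, …, xᵢ xₙ₋₁` in `p`; the one of `xᵢ xᵢ` is that of `xᵢ²`. -/
noncomputable def quadRow {n : ℕ} (p : MvPolynomial (Fin n) (ZMod 2)) (i : Fin n) :
    List (ZMod 2) :=
  List.ofFn (fun j => p.coeff (Finsupp.single i 1 + Finsupp.single j 1))

/-- All coefficients of an instance, in rows: first the linear and constant coefficients of `q`,
then the `n × n` symmetric table of the coefficients of `xᵢ xⱼ` in `q` (so for `i ≠ j` the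
coefficient occurs twice), then one row for each linear polynomial. -/
noncomputable def rows (I : QuadLinSystem) : List (List (ZMod 2)) :=
  affineRow I.q :: (List.ofFn (fun i => quadRow I.q i) ++ List.ofFn (fun i => affineRow (I.ℓ i)))

/-- The input word of an instance, over the three-letter alphabet `Option (ZMod 2)`: the rows of
coefficients one after the other, each of them followed by the separator `none`. -/
noncomputable def encode (I : QuadLinSystem) : List (Option (ZMod 2)) :=
  I.rows.flatMap (fun r => r.map some ++ [none])

theorem flatMap_separator_injective : ∀ L M : List (List (ZMod 2)),
    L.flatMap (fun r => r.map some ++ [none]) = M.flatMap (fun r => r.map some ++ [none]) → L = M := by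
  intro L
  induction L with
  | nil => intro M h; cases M <;> simp_all
  | cons a L ih =>
    intro M h
    cases M with
    | nil => simp_all
    | cons b M =>
      have key : ∀ a b : List (ZMod 2), ∀ X Y : List (Option (ZMod 2)),
          a.map some ++ none :: X = b.map some ++ none :: Y → a = b ∧ X = Y := by
        intro a
        induction a with
        | nil => intro b X Y h; cases b <;> simp_all
        | cons c a iha =>
          intro b X Y h
          cases b with
          | nil => simp_all
          | cons d b =>
            simp at h
            obtain ⟨h1, h2⟩ := iha b X Y h.2
            simp_all
      simp only [List.flatMap_cons, List.append_assoc, List.singleton_append] at h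
      obtain ⟨h1, h2⟩ := key a b _ _ h
      rw [h1, ih M h2]

theorem eq_zero_or_single_add {n d : ℕ} (m : Fin n →₀ ℕ) (h : m.degree ≤ d + 1) :
    m = 0 ∨ ∃ i m', m = Finsupp.single i 1 + m' ∧ m'.degree ≤ d := by
  by_cases h0 : m = 0
  · exact Or.inl h0
  · right
    obtain ⟨i, hi⟩ := Finsupp.ne_iff.1 h0
    have hle : Finsupp.single i 1 ≤ m := by
      simp at hi ⊢; omega
    refine ⟨i, m - Finsupp.single i 1, (add_tsub_cancel_of_le hle).symm, ?_⟩
    have : (Finsupp.single i 1 + (m - Finsupp.single i 1)).degree = m.degree := by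
      rw [add_tsub_cancel_of_le hle]
    rw [map_add, Finsupp.degree_single] at this
    omega

theorem coeff_eq_zero_of_degree {n d : ℕ} (p : MvPolynomial (Fin n) (ZMod 2)) (hp : p.totalDegree ≤ d) (m : Fin n →₀ ℕ)
    (h : ¬ m.degree ≤ d) : p.coeff m = 0 := by
  apply MvPolynomial.coeff_eq_zero_of_totalDegree_lt
  rw [Finsupp.degree] at h
  simp at h
  exact lt_of_le_of_lt hp h

/-- Distinct instances have distinct input words. -/
theorem encode_injective : Function.Injective encode := by
  rintro ⟨n, q, hq, k, l, hl⟩ ⟨n', q', hq', k', l', hl'⟩ h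
  have h := flatMap_separator_injective _ _ h
  simp only [rows, List.cons.injEq] at h
  obtain ⟨h1, h2⟩ := h
  have hn := congrArg List.length h1
  simp [affineRow] at hn
  subst hn
  have hlen := congrArg List.length h2
  simp at hlen
  subst hlen
  obtain ⟨h3, h4⟩ := List.append_inj h2 (by simp)
  have aff : ∀ p p' : MvPolynomial (Fin n) (ZMod 2), affineRow p = affineRow p' →
     p.coeff 0 = p'.coeff 0 ∧ ∀ i, p.coeff (Finsupp.single i 1) = p'.coeff (Finsupp.single i 1) := by
    intro p p' h
    obtain ⟨ha, hb⟩ := List.append_inj h (by simp)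
    exact ⟨by simpa using hb, fun i => congrFun (List.ofFn_injective ha) i⟩
  have hqq : q = q' := by
    ext m
    by_cases hm : m.degree ≤ 2
    · rcases eq_zero_or_single_add m hm with rfl | ⟨i, m', rfl, hm'⟩
      · exact (aff _ _ h1).1
      · rcases eq_zero_or_single_add m' hm' with rfl | ⟨j, m'', rfl, hm''⟩
        · simpa using (aff _ _ h1).2 i
        · have : m'' = 0 := by simpa [Finsupp.degree_eq_zero_iff] using hm''
          subst this
          have := congrFun (List.ofFn_injective (congrFun (List.ofFn_injective h3) i)) j
          simpa using this
    · rw [coeff_eq_zero_of_degree q hq m hm, coeff_eq_zero_of_degree q' hq' m hm]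
  have hll : l = l' := by
    funext t
    have ht := aff _ _ (congrFun (List.ofFn_injective h4) t)
    ext m
    by_cases hm : m.degree ≤ 1
    · rcases eq_zero_or_single_add m hm with rfl | ⟨i, m', rfl, hm'⟩
      · exact ht.1
      · have : m' = 0 := by simpa [Finsupp.degree_eq_zero_iff] using hm'
        subst this
        simpa using ht.2 i
    · rw [coeff_eq_zero_of_degree _ (hl t) m hm, coeff_eq_zero_of_degree _ (hl' t) m hm]
  subst hqq hll
  rfl

end QuadLinSystem

/-! Over GF(2) one has 2·[a = 0] = 1 + (-1)^a. Hence twice the number of solutions is S + E, where S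
(`linSum`) counts the solutions of the linear system and E (`expSum`) sums (-1)^q over them
(`two_mul_numSolutions`). Both sums are computed by eliminating the variables one at a time. Affine
forms are treated as linear ones by giving every point a last coordinate 1.

Write q = x·m + q', where x is the first variable and the affine form m and the polynomial q'
involve only the others; since x² = x, the coefficient of x² goes into m. If some equation contains
x, it reads x = λ. Substitution then leaves the sum unchanged, replaces q by q' + m·λ and removes x
from the other equations. If no equation contains x, summing (-1)^(x·m) over x gives 2·[m = 0], so E
acquires a factor 2 and the new equation m = 0. In S a variable that is free in the original
equations gives just a factor 2.

S and E are reduced in the same pass. Original equations carry tag 0 and those created for E carry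
tag 1, and an original pivot is preferred, so that derived equations never contaminate S. To make
the program uniform, λ is 0 when there is no pivot, and the new equation is a zero row when there is
one. `sums_elim` is this step. Each step removes a variable and adds one row, so the tables remain
of polynomial size.

When no variable is left, S is 0 or 2^s and E is 0 or ±2^c, with c ≤ s. The exponents are kept as
unary counters, from which the binary digits of (S + E)/2 can be written directly (`exec_output`).

For the machine, programs in a small structured language have a big-step semantics `Exec` with a
time bound, and `Exec.evalsTo` shows that compilation to `TM2` respects this bound. Each loop is
then verified by induction on the word it consumes. -/

open Computability StateTransition

/-! ### A structured programming language for a multi-stack machine -/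

namespace StackMachine

/-- Symbols of the working stacks: field elements and the separator `none`. -/
abbrev Sym := Option (ZMod 2)

/-- The working stacks. -/
inductive Stack
  | inp | tri | lin | lam | piv | lamTmp | pivTmp | aux | cntS | cntC
  deriving DecidableEq

instance : Fintype Stack where
  elems := {.inp, .tri, .lin, .lam, .piv, .lamTmp, .pivTmp, .aux, .cntS, .cntC}
  complete k := by cases k <;> decide

/-- The finite internal memory. -/
@[ext]
structure Reg where
  top : Option Sym
  x : ZMod 2
  y : ZMod 2
  z : ZMod 2
  a : ZMod 2
  b : ZMod 2
  d : ZMod 2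
  h : ZMod 2
  tag : ZMod 2
  found : Bool
  orig : Bool

noncomputable instance : Fintype Reg :=
  Fintype.ofInjective
    (fun r => (r.top, r.x, r.y, r.z, r.a, r.b, r.d, r.h, r.tag, r.found, r.orig)) (by
      intro r s h
      simp only [Prod.mk.injEq] at h
      ext1 <;> simp_all)

/-- The initial content of the memory. -/
def Reg.init : Reg := ⟨none, 0, 0, 0, 0, 0, 0, 0, 0, false, false⟩

/-- The memory, the working stacks and the output stack. -/
structure State where
  reg : Reg
  inp : List Sym
  tri : List Sym
  lin : List Sym
  lam : List Sym
  piv : List Sym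
  lamTmp : List Sym
  pivTmp : List Sym
  aux : List Sym
  cntS : List Sym
  cntC : List Sym
  out : List Bool

namespace State

/-- The content of a working stack. -/
def get (s : State) : Stack → List Sym
  | .inp => s.inp
  | .tri => s.tri
  | .lin => s.lin
  | .lam => s.lam
  | .piv => s.piv
  | .lamTmp => s.lamTmp
  | .pivTmp => s.pivTmp
  | .aux => s.aux
  | .cntS => s.cntS
  | .cntC => s.cntC

/-- Replace the content of a working stack. -/
def set (s : State) (k : Stack) (l : List Sym) : State :=
  match k with
  | .inp => { s with inp := l }
  | .tri => { s with tri := l }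
  | .lin => { s with lin := l }
  | .lam => { s with lam := l }
  | .piv => { s with piv := l }
  | .lamTmp => { s with lamTmp := l }
  | .pivTmp => { s with pivTmp := l }
  | .aux => { s with aux := l }
  | .cntS => { s with cntS := l }
  | .cntC => { s with cntC := l }

/-- Replace the content of the memory. -/
def setReg (s : State) (r : Reg) : State := { s with reg := r }

theorem get_set_self (s : State) (k : Stack) (l : List Sym) : (s.set k l).get k = l := by
  cases k <;> rfl

theorem get_set_of_ne (s : State) {k k' : Stack} (h : k' ≠ k) (l : List Sym) :
    (s.set k l).get k' = s.get k' := by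
  cases k <;> cases k' <;> first | rfl | exact absurd rfl h

theorem set_get_self (s : State) (k : Stack) : s.set k (s.get k) = s := by
  cases k <;> rfl

theorem set_set_self (s : State) (k : Stack) (l l' : List Sym) :
    (s.set k l).set k l' = s.set k l' := by
  cases k <;> rfl

theorem set_set_comm (s : State) {k k' : Stack} (h : k ≠ k') (l l' : List Sym) :
    (s.set k l).set k' l' = (s.set k' l').set k l := by
  cases k <;> cases k' <;> first | rfl | exact absurd rfl h

@[simp]
theorem set_reg (s : State) (k : Stack) (l : List Sym) : (s.set k l).reg = s.reg := by
  cases k <;> rfl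

@[simp]
theorem set_out (s : State) (k : Stack) (l : List Sym) : (s.set k l).out = s.out := by
  cases k <;> rfl

@[simp]
theorem setReg_reg (s : State) (r : Reg) : (s.setReg r).reg = r := rfl

@[simp]
theorem setReg_get (s : State) (r : Reg) (k : Stack) : (s.setReg r).get k = s.get k := by
  cases k <;> rfl

theorem setReg_set (s : State) (r : Reg) (k : Stack) (l : List Sym) :
    (s.setReg r).set k l = (s.set k l).setReg r := by
  cases k <;> rfl

@[simp]
theorem setReg_setReg (s : State) (r r' : Reg) : (s.setReg r).setReg r' = s.setReg r' := rfl

end State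

/-- The elementary operations. -/
inductive Op
  | push (k : Stack) (f : Reg → Sym)
  | pop (k : Stack) (f : Reg → Option Sym → Reg)
  | load (f : Reg → Reg)
  | emit (f : Reg → Bool)

/-- The effect of an elementary operation. -/
def Op.apply (s : State) : Op → State
  | .push k f => s.set k (f s.reg :: s.get k)
  | .pop k f => (s.set k (s.get k).tail).setReg (f s.reg (s.get k).head?)
  | .load f => s.setReg (f s.reg)
  | .emit f => { s with out := f s.reg :: s.out }

/-- Structured programs. -/
inductive Cmd
  | ops (l : List Op)
  | seq (p q : Cmd)
  | ite (c : Reg → Bool) (p q : Cmd)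
  | loop (c : Reg → Bool) (p : Cmd)

/-- `Exec p s s' t`: program `p` leads from `s` to `s'` in at most `t` machine steps. -/
inductive Exec : Cmd → State → State → ℕ → Prop
  | ops (l : List Op) (s : State) : Exec (.ops l) s (l.foldl Op.apply s) 1
  | seq {p q : Cmd} {s₁ s₂ s₃ : State} {t₁ t₂ : ℕ} (h₁ : Exec p s₁ s₂ t₁) (h₂ : Exec q s₂ s₃ t₂) :
      Exec (.seq p q) s₁ s₃ (t₁ + t₂)
  | ite_true {c : Reg → Bool} {p q : Cmd} {s s' : State} {t : ℕ} (hc : c s.reg = true)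
      (h : Exec p s s' t) : Exec (.ite c p q) s s' (t + 1)
  | ite_false {c : Reg → Bool} {p q : Cmd} {s s' : State} {t : ℕ} (hc : c s.reg = false)
      (h : Exec q s s' t) : Exec (.ite c p q) s s' (t + 1)
  | loop_false {c : Reg → Bool} {p : Cmd} {s : State} (hc : c s.reg = false) :
      Exec (.loop c p) s s 1
  | loop_true {c : Reg → Bool} {p : Cmd} {s₁ s₂ s₃ : State} {t₁ t₂ : ℕ} (hc : c s₁.reg = true)
      (h₁ : Exec p s₁ s₂ t₁) (h₂ : Exec (.loop c p) s₂ s₃ t₂) :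
      Exec (.loop c p) s₁ s₃ (t₁ + t₂ + 1)
  | mono {p : Cmd} {s s' : State} {t t' : ℕ} (h : Exec p s s' t) (ht : t ≤ t') : Exec p s s' t'

theorem Exec.cast {p : Cmd} {s s₁ s' : State} {t t' : ℕ} (h : Exec p s s₁ t) (hs : s₁ = s')
    (ht : t ≤ t') : Exec p s s' t' :=
  hs ▸ h.mono ht

/-! ### Compilation -/

/-- All stacks of the compiled machine: the output stack `none` and the working stacks. -/
abbrev Gam : Option Stack → Type
  | none => Bool
  | some _ => Sym

/-- The stacks of a state, as the compiled machine sees them. -/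
def State.stk (s : State) : ∀ k, List (Gam k)
  | none => s.out
  | some k => s.get k

theorem State.update_stk_some (s : State) (k : Stack) (l : List Sym) :
    Function.update s.stk (some k) l = (s.set k l).stk := by
  funext k'
  cases k' with
  | none => simp [State.stk]
  | some k' =>
    by_cases h : k' = k
    · subst h; simp [State.stk, get_set_self]
    · rw [Function.update_of_ne (by simpa using h)]
      exact (get_set_of_ne s h l).symm

theorem State.update_stk_none (s : State) (l : List Bool) :
    Function.update s.stk none l = ({ s with out := l } : State).stk := by
  funext k'
  rcases k' with _ | k'
  · simp [State.stk]
  · rw [Function.update_of_ne (by simp)]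
    cases k' <;> rfl

theorem State.setReg_stk (s : State) (r : Reg) : (s.setReg r).stk = s.stk := by
  funext k'
  rcases k' with _ | k'
  · rfl
  · exact State.setReg_get s r k'

/-- The program points of a structured program. -/
def Cmd.Lab : Cmd → Type
  | .ops _ => Unit
  | .seq p q => p.Lab ⊕ q.Lab
  | .ite _ p q => Option (p.Lab ⊕ q.Lab)
  | .loop _ p => Option p.Lab

noncomputable instance Cmd.fintypeLab : (p : Cmd) → Fintype p.Lab
  | .ops _ => inferInstanceAs (Fintype Unit)
  | .seq p q =>
    letI := Cmd.fintypeLab p; letI := Cmd.fintypeLab q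
    inferInstanceAs (Fintype (p.Lab ⊕ q.Lab))
  | .ite _ p q =>
    letI := Cmd.fintypeLab p; letI := Cmd.fintypeLab q
    inferInstanceAs (Fintype (Option (p.Lab ⊕ q.Lab)))
  | .loop _ p =>
    letI := Cmd.fintypeLab p
    inferInstanceAs (Fintype (Option p.Lab))

/-- The point where the execution of a structured program starts. -/
def Cmd.entry : (p : Cmd) → p.Lab
  | .ops _ => ()
  | .seq p _ => Sum.inl p.entry
  | .ite _ _ _ => (none : Option _)
  | .loop _ _ => (none : Option _)

variable {Λ : Type}

/-- Translation of an elementary operation. -/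
def Op.code (q : Turing.TM2.Stmt Gam Λ Reg) : Op → Turing.TM2.Stmt Gam Λ Reg
  | .push k f => .push (some k) f q
  | .pop k f => .pop (some k) f q
  | .load f => .load f q
  | .emit f => .push none f q

theorem Op.stepAux_code (q : Turing.TM2.Stmt Gam Λ Reg) (o : Op) (s : State) :
    Turing.TM2.stepAux (o.code q) s.reg s.stk =
      Turing.TM2.stepAux q (o.apply s).reg (o.apply s).stk := by
  cases o with
  | push k f =>
    simp only [Op.code, Op.apply, Turing.TM2.stepAux, State.set_reg]
    rw [← State.update_stk_some]; rfl
  | pop k f =>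
    simp only [Op.code, Op.apply, Turing.TM2.stepAux, State.setReg_reg, State.setReg_stk]
    rw [← State.update_stk_some]; rfl
  | load f => simp only [Op.code, Op.apply, Turing.TM2.stepAux, State.setReg_reg, State.setReg_stk]
  | emit f =>
    simp only [Op.code, Op.apply, Turing.TM2.stepAux]
    rw [State.update_stk_none]; rfl

/-- A block of operations compiles to one `TM2` statement, executed within a single machine step;
hence the cost 1 in `Exec.ops`. -/
theorem stepAux_foldr_code (q : Turing.TM2.Stmt Gam Λ Reg) (l : List Op) (s : State) :
    Turing.TM2.stepAux (l.foldr (fun o r => o.code r) q) s.reg s.stk =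
      Turing.TM2.stepAux q (l.foldl Op.apply s).reg (l.foldl Op.apply s).stk := by
  induction l generalizing s with
  | nil => rfl
  | cons o l ih => rw [List.foldr_cons, Op.stepAux_code, ih, List.foldl_cons]

/-- Translation of a structured program, whose points are embedded by `e` into the labels of the
machine; `x` is the label to continue with. -/
def Cmd.code : (p : Cmd) → (p.Lab → Λ) → Λ → p.Lab → Turing.TM2.Stmt Gam Λ Reg
  | .ops l, _, x, _ => l.foldr (fun o r => o.code r) (.goto fun _ => x)
  | .seq p q, e, x, n =>
    match n with
    | Sum.inl n => p.code (fun i => e (Sum.inl i)) (e (Sum.inr q.entry)) n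
    | Sum.inr n => q.code (fun i => e (Sum.inr i)) x n
  | .ite c p q, e, x, n =>
    match n with
    | none => .branch c (.goto fun _ => e (some (Sum.inl p.entry)))
        (.goto fun _ => e (some (Sum.inr q.entry)))
    | some (Sum.inl n) => p.code (fun i => e (some (Sum.inl i))) x n
    | some (Sum.inr n) => q.code (fun i => e (some (Sum.inr i))) x n
  | .loop c p, e, x, n =>
    match n with
    | none => .branch c (.goto fun _ => e (some p.entry)) (.goto fun _ => x)
    | some n => p.code (fun i => e (some i)) (e none) n

/-- The configuration at label `l` in state `s`. -/
def State.cfg (s : State) (l : Option Λ) : Turing.TM2.Cfg Gam Λ Reg := ⟨l, s.reg, s.stk⟩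

theorem step_branch {M : Λ → Turing.TM2.Stmt Gam Λ Reg} {l l₁ l₂ : Λ} {c : Reg → Bool}
    (hM : M l = .branch c (.goto fun _ => l₁) (.goto fun _ => l₂)) (s : State) :
    Turing.TM2.step M (s.cfg (some l)) = some (s.cfg (some (bif c s.reg then l₁ else l₂))) := by
  simp only [State.cfg, Turing.TM2.step, hM, Turing.TM2.stepAux]
  cases c s.reg <;> rfl

theorem evalsTo_single {σ : Type*} {f : σ → Option σ} {a b : σ} (h : f a = some b) :
    Nonempty (EvalsToInTime f a (some b) 1) :=
  ⟨⟨⟨1, h⟩, le_rfl⟩⟩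

theorem evalsTo_trans {σ : Type*} {f : σ → Option σ} {a b c : σ} {t₁ t₂ t : ℕ}
    (h₁ : Nonempty (EvalsToInTime f a (some b) t₁)) (h₂ : Nonempty (EvalsToInTime f b (some c) t₂))
    (ht : t₁ + t₂ ≤ t) : Nonempty (EvalsToInTime f a (some c) t) := by
  obtain ⟨h₁⟩ := h₁
  obtain ⟨h₂⟩ := h₂
  have h := EvalsToInTime.trans f _ _ _ _ _ h₁ h₂
  exact ⟨⟨h.toEvalsTo, h.steps_le_m.trans (by omega)⟩⟩

/-- The compiled code simulates the program. -/
theorem Exec.evalsTo {p : Cmd} {s s' : State} {t : ℕ} (h : Exec p s s' t)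
    (M : Λ → Turing.TM2.Stmt Gam Λ Reg) (e : p.Lab → Λ) (x : Λ) (hM : ∀ i, M (e i) = p.code e x i) :
    Nonempty (EvalsToInTime (Turing.TM2.step M) (s.cfg (some (e p.entry)))
      (some (s'.cfg (some x))) t) := by
  induction h generalizing x with
  | ops l s =>
    refine evalsTo_single ?_
    simp only [State.cfg, Turing.TM2.step, hM, Cmd.code]
    rw [stepAux_foldr_code]
    rfl
  | seq _ _ ih₁ ih₂ =>
    exact evalsTo_trans (ih₁ (fun i => e (Sum.inl i)) _ fun i => hM (Sum.inl i))
      (ih₂ (fun i => e (Sum.inr i)) _ fun i => hM (Sum.inr i)) le_rfl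
  | ite_true hc _ ih =>
    refine evalsTo_trans (evalsTo_single ?_)
      (ih (fun i => e (some (Sum.inl i))) _ fun i => hM (some (Sum.inl i))) (add_comm _ _).le
    exact (step_branch (hM none) _).trans (by rw [hc]; rfl)
  | ite_false hc _ ih =>
    refine evalsTo_trans (evalsTo_single ?_)
      (ih (fun i => e (some (Sum.inr i))) _ fun i => hM (some (Sum.inr i))) (add_comm _ _).le
    exact (step_branch (hM none) _).trans (by rw [hc]; rfl)
  | loop_false hc =>
    refine evalsTo_single ?_
    exact (step_branch (hM none) _).trans (by rw [hc]; rfl)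
  -- The body is compiled with the loop head as its continuation, so after one round the induction
  -- hypothesis for the same loop applies.
  | loop_true hc _ _ ih₁ ih₂ =>
    refine evalsTo_trans (evalsTo_single ?_) (evalsTo_trans
      (ih₁ (fun i => e (some i)) _ fun i => hM (some i)) (ih₂ e x hM) le_rfl) (by omega)
    exact (step_branch (hM none) _).trans (by rw [hc]; rfl)
  | mono _ ht ih =>
    obtain ⟨h⟩ := ih e x hM
    exact ⟨⟨h.toEvalsTo, h.steps_le_m.trans ht⟩⟩

/-- The machine that runs a structured program and halts. -/
noncomputable def Cmd.machine (p : Cmd) : Turing.FinTM2 where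
  K := Option Stack
  k₀ := some .inp
  k₁ := none
  Γ := Gam
  Λ := Option p.Lab
  main := some p.entry
  σ := Reg
  initialState := Reg.init
  Γk₀Fin := inferInstanceAs (Fintype Sym)
  m
    | none => .halt
    | some i => p.code some none i

/-- The state with all working stacks empty but the input. -/
def State.start (l : List Sym) : State := ⟨Reg.init, l, [], [], [], [], [], [], [], [], [], []⟩

/-- The state with all stacks empty but the output. -/
def State.final (l : List Bool) : State := ⟨Reg.init, [], [], [], [], [], [], [], [], [], [], l⟩

/-- The label `none` carries the statement `halt`, which accounts for the extra step. -/
theorem Exec.outputs {p : Cmd} {l : List Sym} {l' : List Bool} {t : ℕ}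
    (h : Exec p (.start l) (.final l') t) :
    Nonempty (Turing.TM2OutputsInTime p.machine l (some l') (t + 1)) := by
  have h₁ := h.evalsTo p.machine.m some none fun i => rfl
  have h₂ : Nonempty (EvalsToInTime (Turing.TM2.step p.machine.m)
      ((State.final l').cfg (some none)) (some ((State.final l').cfg none)) 1) :=
    evalsTo_single rfl
  have h₃ := evalsTo_trans h₁ h₂ le_rfl
  have e₁ : Turing.initList p.machine l = (State.start l).cfg (some (some p.entry)) := by
    unfold Turing.initList State.cfg
    congr 1
    funext k
    rcases k with _ | k
    · rfl
    · cases k <;> rfl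
  have e₂ : Turing.haltList p.machine l' = (State.final l').cfg none := by
    unfold Turing.haltList State.cfg
    congr 1
    funext k
    rcases k with _ | k
    · rfl
    · cases k <;> rfl
  have h₄ : Nonempty (EvalsToInTime p.machine.step (Turing.initList p.machine l)
      (some (Turing.haltList p.machine l')) (t + 1)) := by
    rw [e₁, e₂]
    exact h₃
  exact h₄

/-- A program of polynomial running time yields a polynomial-time machine. -/
theorem computableInPolyTime {α : Type} (enc : α → List Sym) (f : α → ℕ) (p : Cmd)
    (time : Polynomial ℕ)
    (h : ∀ a, Exec p (.start (enc a)) (.final (encodeNat (f a))) (time.eval (enc a).length)) :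
    Nonempty (Turing.TM2ComputableInPolyTime enc encodeNat f) := by
  refine ⟨⟨⟨p.machine, Equiv.refl _, Equiv.refl _⟩, time + 1, fun a => ?_⟩⟩
  have h' := (h a).outputs.some
  rw [Polynomial.eval_add, Polynomial.eval_one]
  have e₁ : List.map (Equiv.refl (p.machine.Γ p.machine.k₀)).invFun (enc a) = enc a :=
    List.map_id _
  have e₂ : List.map (Equiv.refl (p.machine.Γ p.machine.k₁)).invFun (encodeNat (f a)) =
    encodeNat (f a) := List.map_id _
  exact e₁.symm ▸ e₂.symm ▸ h'

/-! ### Loops that empty a stack -/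

/-- The field element held by a stack symbol, `0` if there is none. -/
def val (o : Option Sym) : ZMod 2 := (o.getD none).getD 0

/-- Is the last symbol read a field element? -/
def isVal (r : Reg) : Bool :=
  match r.top with
  | some (some _) => true
  | _ => false

/-- Was there a last symbol read? -/
def isSym (r : Reg) : Bool := r.top.isSome

/-- Read the top of a stack into `top` and `x`. -/
def popTop (k : Stack) : Op := .pop k fun r o => { r with top := o, x := val o }

/-- The effect of `popTop`. -/
def State.popped (s : State) (k : Stack) : State :=
  (s.set k (s.get k).tail).setReg { s.reg with top := (s.get k).head?, x := val (s.get k).head? }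

/-- Pop stack `k` and run `p`, as long as the symbol read satisfies `c`. -/
def each (c : Reg → Bool) (k : Stack) (p : Cmd) : Cmd :=
  .seq (.ops [popTop k]) (.loop c (.seq p (.ops [popTop k])))

theorem Exec.ops_to {l : List Op} {s s' : State} (h : l.foldl Op.apply s = s') :
    Exec (.ops l) s s' 1 :=
  (Exec.ops _ _).cast h le_rfl

/-- This inversion, like the next one, needs an induction because any number of `mono` may sit on
top of the derivation. -/
theorem Exec.of_ops {l : List Op} {s s' : State} {t : ℕ} (h : Exec (.ops l) s s' t) :
    s' = l.foldl Op.apply s ∧ 1 ≤ t := by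
  generalize hp : Cmd.ops l = p at h
  induction h with
  | ops l s => cases hp; exact ⟨rfl, le_rfl⟩
  | mono _ ht ih => exact ⟨(ih hp).1, (ih hp).2.trans ht⟩
  | _ => cases hp

theorem Exec.of_seq {p q : Cmd} {s s' : State} {t : ℕ} (h : Exec (.seq p q) s s' t) :
    ∃ s₁ t₁ t₂, Exec p s s₁ t₁ ∧ Exec q s₁ s' t₂ ∧ t₁ + t₂ ≤ t := by
  generalize hp : Cmd.seq p q = p' at h
  induction h with
  | seq h₁ h₂ => cases hp; exact ⟨_, _, _, h₁, h₂, le_rfl⟩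
  | mono _ ht ih =>
    obtain ⟨s₁, t₁, t₂, h₁, h₂, h⟩ := ih hp
    exact ⟨s₁, t₁, t₂, h₁, h₂, h.trans ht⟩
  | _ => cases hp

theorem exec_each_stop {c : Reg → Bool} {k : Stack} {p : Cmd} (s : State)
    (hc : c (s.popped k).reg = false) : Exec (each c k p) s (s.popped k) 2 :=
  .seq (.ops _ _) (.loop_false hc)

/-- The pop ending a round is the pop that starts `each` afresh, so a loop unrolls into one round
followed by the same `each`. This is the inductive step for all the loops below; the 2 pays for a
pop and a test. -/
theorem exec_each_step {c : Reg → Bool} {k : Stack} {p : Cmd} {s s' s'' : State} {t t' : ℕ}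
    (hc : c (s.popped k).reg = true) (h : Exec p (s.popped k) s' t)
    (h' : Exec (each c k p) s' s'' t') : Exec (each c k p) s s'' (t + t' + 2) := by
  obtain ⟨s₁, t₁, t₂, h₁, h₂, ht⟩ := h'.of_seq
  obtain ⟨rfl, ht₁⟩ := h₁.of_ops
  exact (Exec.seq (.ops _ _) (.loop_true hc (.seq h (.ops _ _)) h₂)).mono (by omega)

/-- Move the content of stack `k` to stack `k'`, reversing it. -/
def move (k k' : Stack) : Cmd := each isSym k (.ops [.push k' fun r => r.top.getD none])

theorem exec_move {k k' : Stack} (hk : k' ≠ k) (s : State) :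
    Exec (move k k') s
      (((s.set k []).set k' ((s.get k).reverse ++ s.get k')).setReg { s.reg with top := none, x := 0 })
      (3 * (s.get k).length + 2) := by
  generalize hl : s.get k = l
  induction l generalizing s with
  | nil =>
    refine (exec_each_stop s ?_).cast ?_ (by simp)
    · simp [State.popped, hl, isSym]
    · have : s.set k' (s.get k') = s := State.set_get_self _ _
      simp only [State.popped, hl, List.reverse_nil, List.nil_append]
      rw [State.set_set_comm _ hk.symm, this]
      rfl
  | cons a l ih =>
    have h₂ := ih (((s.set k l).set k' (a :: s.get k')).setReg { s.reg with top := some a, x := val (some a) })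
      (by rw [State.setReg_get, State.get_set_of_ne _ hk.symm, State.get_set_self])
    refine (exec_each_step (t := 1) ?_ ?_ h₂).cast ?_ ?_
    · simp [State.popped, hl, isSym]
    · refine (Exec.ops _ _).cast ?_ le_rfl
      simp only [List.foldl, Op.apply, State.popped, hl, State.setReg_set, State.setReg_reg,
        State.setReg_get, State.get_set_of_ne _ hk]
      rfl
    · simp only [State.setReg_set, State.setReg_setReg, State.setReg_get, State.get_set_self,
        State.setReg_reg, List.reverse_cons, List.append_assoc, List.singleton_append]
      rw [State.set_set_comm _ hk, State.set_set_self, State.set_set_self]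
    · simp; omega

/-! ### Rows of field elements -/

/-- Combination of three lists entry by entry. -/
def zip3 (g : ZMod 2 → ZMod 2 → ZMod 2 → ZMod 2) :
    List (ZMod 2) → List (ZMod 2) → List (ZMod 2) → List (ZMod 2)
  | x :: xs, y :: ys, z :: zs => g x y z :: zip3 g xs ys zs
  | _, _, _ => []

@[simp]
theorem length_zip3 (g : ZMod 2 → ZMod 2 → ZMod 2 → ZMod 2) : ∀ {xs ys zs : List (ZMod 2)},
    ys.length = xs.length → zs.length = xs.length → (zip3 g xs ys zs).length = xs.length
  | [], _, _, _, _ => by simp [zip3]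
  | x :: xs, y :: ys, z :: zs, h, h' => by
    simp only [List.length_cons, Nat.add_right_cancel_iff] at h h'
    simp [zip3, length_zip3 g h h']

/-- Set the scratch registers. -/
def Reg.scratch (r : Reg) (t : Option Sym) (x y z : ZMod 2) : Reg :=
  { r with top := t, x := x, y := y, z := z }

/-- Read a row from stack `k` together with rows on `lam` and `piv`; write a combined row on `aux`,
and replace the row on `lam` by another combination. -/
def zipRow (k : Stack) (f f' : Reg → ZMod 2) : Cmd :=
  .seq (each isVal k (.ops [.pop .lam fun r o => { r with y := val o },
    .pop .piv fun r o => { r with z := val o }, .push .aux fun r => some (f r),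
    .push .lamTmp fun r => some (f' r), .push .pivTmp fun r => some r.z]))
  (.seq (.ops [.push .aux fun _ => none, .load fun r => r.scratch none 0 0 0])
  (.seq (move .lamTmp .lam) (move .pivTmp .piv)))

/-- `f` and `f'` may also read registers that stay fixed during the loop (a head, a flag); `hf` and
`hf'` isolate the dependence on the three entries just read. The existential `y` and `z` are
leftovers in the scratch registers. -/
theorem exec_zipLoop {k : Stack} (hk : k = .tri ∨ k = .lin) {f f' : Reg → ZMod 2}
    {g g' : ZMod 2 → ZMod 2 → ZMod 2 → ZMod 2} {r : Reg}
    (hf : ∀ t x y z, f (r.scratch t x y z) = g x y z)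
    (hf' : ∀ t x y z, f' (r.scratch t x y z) = g' x y z) {xs ys zs : List (ZMod 2)}
    (hy : ys.length = xs.length) (hz : zs.length = xs.length) (s : State) {rest : List Sym}
    {t : Option Sym} {x y z : ZMod 2}
    (hr : s.reg = r.scratch t x y z)
    (hs : s.get k = xs.map some ++ none :: rest) (hl : s.lam = ys.map some)
    (hp : s.piv = zs.map some) :
    ∃ y z, Exec (each isVal k (.ops [.pop .lam fun r o => { r with y := val o },
      .pop .piv fun r o => { r with z := val o }, .push .aux fun r => some (f r),
      .push .lamTmp fun r => some (f' r), .push .pivTmp fun r => some r.z])) s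
      { s.set k rest with
        reg := r.scratch (some none) 0 y z
        aux := ((zip3 g xs ys zs).map some).reverse ++ s.aux
        lam := []
        piv := []
        lamTmp := ((zip3 g' xs ys zs).map some).reverse ++ s.lamTmp
        pivTmp := (zs.map some).reverse ++ s.pivTmp } (3 * xs.length + 2) := by
  induction xs generalizing s ys zs t x y z with
  | nil =>
    obtain rfl : ys = [] := by simpa using hy
    obtain rfl : zs = [] := by simpa using hz
    refine ⟨y, z, (exec_each_stop s ?_).cast ?_ (by simp)⟩
    · simp [State.popped, hs, isVal]
    · obtain ⟨r', inp, tri, lin, lam, piv, lamTmp, pivTmp, aux, cntS, cntC, out⟩ := s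
      simp only [List.map_nil] at hl hp hr
      subst hl hp hr
      rcases hk with rfl | rfl <;>
      · simp only [State.get] at hs
        subst hs
        rfl
  | cons x₀ xs ih =>
    obtain _ | ⟨y₀, ys⟩ := ys
    · simp at hy
    obtain _ | ⟨z₀, zs⟩ := zs
    · simp at hz
    simp only [List.length_cons, Nat.add_right_cancel_iff] at hy hz
    obtain ⟨r', inp, tri, lin, lam, piv, lamTmp, pivTmp, aux, cntS, cntC, out⟩ := s
    simp only [List.map_cons] at hl hp hr
    subst hl hp hr
    rcases hk with rfl | rfl
    · simp only [State.get] at hs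
      subst hs
      obtain ⟨y', z', h⟩ := ih hy hz ⟨r.scratch (some (some x₀)) x₀ y₀ z₀, inp,
        xs.map some ++ none :: rest, lin, ys.map some, zs.map some,
        some (g' x₀ y₀ z₀) :: lamTmp, some z₀ :: pivTmp, some (g x₀ y₀ z₀) :: aux, cntS, cntC, out⟩
        rfl rfl rfl rfl
      refine ⟨y', z', (exec_each_step (t := 1) rfl ?_ h).cast ?_ ?_⟩
      · refine (Exec.ops _ _).cast ?_ le_rfl
        rw [← hf (some (some x₀)), ← hf' (some (some x₀))]
        rfl
      · simp [zip3, State.set]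
      · simp; omega
    · simp only [State.get] at hs
      subst hs
      obtain ⟨y', z', h⟩ := ih hy hz ⟨r.scratch (some (some x₀)) x₀ y₀ z₀, inp, tri,
        xs.map some ++ none :: rest, ys.map some, zs.map some,
        some (g' x₀ y₀ z₀) :: lamTmp, some z₀ :: pivTmp, some (g x₀ y₀ z₀) :: aux, cntS, cntC, out⟩
        rfl rfl rfl rfl
      refine ⟨y', z', (exec_each_step (t := 1) rfl ?_ h).cast ?_ ?_⟩
      · refine (Exec.ops _ _).cast ?_ le_rfl
        rw [← hf (some (some x₀)), ← hf' (some (some x₀))]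
        rfl
      · simp [zip3, State.set]
      · simp; omega

/-- The rows on `lam` and `piv` are consumed and collected in reverse; two moves restore their
order, and the three passes give `9 * n`. The row on `aux` stays reversed until the whole of `aux`
is moved back. -/
theorem exec_zipRow {k : Stack} (hk : k = .tri ∨ k = .lin) {f f' : Reg → ZMod 2}
    {g g' : ZMod 2 → ZMod 2 → ZMod 2 → ZMod 2} (s : State)
    (hf : ∀ t x y z, f (s.reg.scratch t x y z) = g x y z)
    (hf' : ∀ t x y z, f' (s.reg.scratch t x y z) = g' x y z) {xs ys zs : List (ZMod 2)} {n : ℕ}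
    (hx : xs.length = n) (hy : ys.length = n) (hz : zs.length = n) {rest : List Sym}
    (hs : s.get k = xs.map some ++ none :: rest) (hl : s.lam = ys.map some)
    (hp : s.piv = zs.map some) (hlt : s.lamTmp = []) (hpt : s.pivTmp = []) :
    Exec (zipRow k f f') s
      { s.set k rest with
        reg := s.reg.scratch none 0 0 0
        aux := none :: ((zip3 g xs ys zs).map some).reverse ++ s.aux
        lam := (zip3 g' xs ys zs).map some } (9 * n + 7) := by
  subst hx
  obtain ⟨y, z, h⟩ := exec_zipLoop hk hf hf' hy hz s (t := s.reg.top) (x := s.reg.x)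
    (y := s.reg.y) (z := s.reg.z) rfl hs hl hp
  refine (Exec.seq h (.seq (.ops _ _) (.seq (exec_move (by decide) _)
    (exec_move (by decide) _)))).cast ?_ ?_
  · obtain ⟨r', inp, tri, lin, lam, piv, lamTmp, pivTmp, aux, cntS, cntC, out⟩ := s
    dsimp only at hl hp hlt hpt
    subst hl hp hlt hpt
    rcases hk with rfl | rfl <;> simp [State.set, State.get, State.setReg, Op.apply, Reg.scratch]
  · rcases hk with rfl | rfl <;>
    simp [State.set, State.get, State.setReg, Op.apply, hlt, hpt, length_zip3 _ hy hz, hz] <;> omega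

/-! ### Passes over the tables -/

/-- The word of a row. -/
def encRow (r : List (ZMod 2)) : List Sym := r.map some ++ [none]

/-- The word of a table. -/
def encTable (T : List (List (ZMod 2))) : List Sym := T.flatMap encRow

/-- The word of a list of tagged rows. -/
def encTagged (L : List (ZMod 2 × List (ZMod 2))) : List Sym :=
  L.flatMap fun p => some p.1 :: encRow p.2

theorem encTable_cons (r : List (ZMod 2)) (T : List (List (ZMod 2))) :
    encTable (r :: T) = r.map some ++ none :: encTable T := by
  simp [encTable, encRow]

theorem encTagged_cons (t : ZMod 2) (r : List (ZMod 2)) (L : List (ZMod 2 × List (ZMod 2))) :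
    encTagged ((t, r) :: L) = some t :: (r.map some ++ none :: encTagged L) := by
  simp [encTagged, encRow]

theorem length_encTagged_le {n : ℕ} (L : List (ZMod 2 × List (ZMod 2)))
    (hL : ∀ p ∈ L, p.2.length = n) : (encTagged L).length = L.length * (n + 2) := by
  induction L with
  | nil => simp [encTagged]
  | cons p L ih =>
    obtain ⟨t, r⟩ := p
    simp only [List.mem_cons, forall_eq_or_imp] at hL
    rw [encTagged_cons]
    simp only [List.length_cons, List.length_append, List.length_map, ih hL.2, hL.1]
    ring

theorem zip3_fst : ∀ {xs ys zs : List (ZMod 2)}, ys.length = xs.length → zs.length = xs.length →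
    zip3 (fun x _ _ => x) xs ys zs = xs
  | [], _, _, _, _ => by simp [zip3]
  | x :: xs, y :: ys, z :: zs, h, h' => by
    simp only [List.length_cons, Nat.add_right_cancel_iff] at h h'
    simp [zip3, zip3_fst h h']

theorem zip3_snd : ∀ {xs ys zs : List (ZMod 2)}, ys.length = xs.length → zs.length = xs.length →
    zip3 (fun _ y _ => y) xs ys zs = ys
  | [], [], _, _, _ => by simp [zip3]
  | x :: xs, y :: ys, z :: zs, h, h' => by
    simp only [List.length_cons, Nat.add_right_cancel_iff] at h h'
    simp [zip3, zip3_snd h h']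

theorem zip3_ite (c : Prop) [Decidable c] {xs ys zs : List (ZMod 2)} (h : ys.length = xs.length)
    (h' : zs.length = xs.length) :
    zip3 (fun x y _ => if c then x else y) xs ys zs = if c then xs else ys := by
  split_ifs
  · exact zip3_fst h h'
  · exact zip3_snd h h'

/-- The memory between the passes. -/
def Reg.main (d : ZMod 2) (found orig : Bool) : Reg := ⟨none, 0, 0, 0, 0, 0, d, 0, 0, found, orig⟩

/-- The tail of the first row with head `1`, or `l` if there is none or if `found` holds. -/
def pick : Bool → List (ZMod 2 × List (ZMod 2)) → List (ZMod 2) → List (ZMod 2)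
  | _, [], l => l
  | found, p :: L, l =>
    pick (found || p.2.headI == 1) L (if p.2.headI = 1 ∧ found = false then p.2.tail else l)

theorem length_pick {n : ℕ} {L : List (ZMod 2 × List (ZMod 2))} (hL : ∀ p ∈ L, p.2.length = n + 1)
    (found : Bool) {l : List (ZMod 2)} (hl : l.length = n) : (pick found L l).length = n := by
  induction L generalizing found l with
  | nil => exact hl
  | cons p L ih =>
    simp only [List.mem_cons, forall_eq_or_imp] at hL
    refine ih hL.2 _ ?_
    split_ifs
    · simp [hL.1]
    · exact hl

/-- Search `lin` for a row with head `1`, store its tail on `lam`, and move `lin` to `aux`. -/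
def scan : Cmd :=
  each isVal .lin (.seq
    (.ops [.load fun r => { r with tag := r.x }, .push .aux fun r => some r.x,
      .pop .lin fun r o => { r with h := val o }, .push .aux fun r => some r.h])
    (.seq (zipRow .lin (fun r => r.x) fun r => if r.h = 1 ∧ r.found = false then r.x else r.y)
    (.ops [.load fun r => { r with
      found := r.found || r.h == 1, orig := r.orig || (r.h == 1 && r.tag == 0), h := 0, tag := 0 }])))

/-- Tag and head of each row are read separately, so `zipRow` sees only the tail, which has the
length of the row on `lam`. The table itself reaches `aux` unchanged. -/
theorem exec_scan {n : ℕ} {L : List (ZMod 2 × List (ZMod 2))} (hL : ∀ p ∈ L, p.2.length = n + 1)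
    (d : ZMod 2) (found orig : Bool) {lam piv : List (ZMod 2)} (hlam : lam.length = n)
    (hpiv : piv.length = n) (inp tri aux cntS cntC : List Sym) (out : List Bool) :
    Exec scan
      ⟨.main d found orig, inp, tri, encTagged L, lam.map some, piv.map some, [], [], aux,
        cntS, cntC, out⟩
      ⟨.main d (found || L.any fun p => p.2.headI == 1)
          (orig || L.any fun p => p.2.headI == 1 && p.1 == 0),
        inp, tri, [], (pick found L lam).map some, piv.map some, [], [],
        (encTagged L).reverse ++ aux, cntS, cntC, out⟩
      (L.length * (9 * n + 11) + 2) := by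
  induction L generalizing found orig lam aux with
  | nil => exact (exec_each_stop _ rfl).cast (by simp [pick, encTagged]; rfl) (by simp)
  | cons p L ih =>
    obtain ⟨t, r⟩ := p
    simp only [List.mem_cons, forall_eq_or_imp] at hL
    obtain ⟨hr, hL⟩ := hL
    obtain _ | ⟨h, r⟩ := r
    · simp at hr
    replace hr : r.length = n := by simpa using hr
    have key := exec_zipRow (k := .lin) (.inr rfl) (f := fun r => r.x)
      (f' := fun r => if r.h = 1 ∧ r.found = false then r.x else r.y)
      (g := fun x _ _ => x) (g' := fun x y _ => if h = 1 ∧ found = false then x else y)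
      ⟨⟨some (some t), t, 0, 0, 0, 0, d, h, t, found, orig⟩, inp, tri,
        r.map some ++ none :: encTagged L, lam.map some, piv.map some, [], [],
        some h :: some t :: aux, cntS, cntC, out⟩
      (fun _ _ _ _ => rfl) (fun _ _ _ _ => rfl) hr hlam hpiv rfl rfl rfl rfl rfl
    rw [zip3_fst (by omega) (by omega), zip3_ite _ (by omega) (by omega)] at key
    have hlam' : (if h = 1 ∧ found = false then r else lam).length = n := by
      split_ifs <;> assumption
    rw [encTagged_cons]
    refine (exec_each_step rfl (.seq (.ops_to (by rfl)) (.seq key (.ops_to (by rfl))))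
      (ih hL (found || h == 1) (orig || (h == 1 && t == 0)) hlam'
        (none :: (r.map some).reverse ++ some h :: some t :: aux))).cast ?_ ?_
    · simp [pick, Bool.or_assoc]
      congr!
    · simp only [List.length_cons]; ring_nf; omega

/-- Add multiples of the rows on `lam` to the rows on `lin`, removing their heads. -/
def addLam : Cmd :=
  each isVal .lin (.seq
    (.ops [.push .aux fun r => some r.x, .pop .lin fun r o => { r with h := val o }])
    (.seq (zipRow .lin (fun r => r.x + r.h * r.y) fun r => r.y)
    (.ops [.load fun r => { r with h := 0 }])))

/-- The row after elimination of its first entry. -/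
def elimRow (lam piv r : List (ZMod 2)) : List (ZMod 2) :=
  zip3 (fun x y _ => x + r.headI * y) r.tail lam piv

theorem exec_addLam {n : ℕ} {L : List (ZMod 2 × List (ZMod 2))} (hL : ∀ p ∈ L, p.2.length = n + 1)
    (d : ZMod 2) (found orig : Bool) {lam piv : List (ZMod 2)} (hlam : lam.length = n)
    (hpiv : piv.length = n) (inp tri aux cntS cntC : List Sym) (out : List Bool) :
    Exec addLam
      ⟨.main d found orig, inp, tri, encTagged L, lam.map some, piv.map some, [], [], aux,
        cntS, cntC, out⟩
      ⟨.main d found orig, inp, tri, [], lam.map some, piv.map some, [], [],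
        (encTagged (L.map fun p => (p.1, elimRow lam piv p.2))).reverse ++ aux, cntS, cntC, out⟩
      (L.length * (9 * n + 11) + 2) := by
  induction L generalizing aux with
  | nil => exact (exec_each_stop _ rfl).cast (by simp [encTagged]; rfl) (by simp)
  | cons p L ih =>
    obtain ⟨t, r⟩ := p
    simp only [List.mem_cons, forall_eq_or_imp] at hL
    obtain ⟨hr, hL⟩ := hL
    obtain _ | ⟨h, r⟩ := r
    · simp at hr
    replace hr : r.length = n := by simpa using hr
    have key := exec_zipRow (k := .lin) (.inr rfl) (f := fun r => r.x + r.h * r.y)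
      (f' := fun r => r.y) (g := fun x y _ => x + h * y) (g' := fun _ y _ => y)
      ⟨⟨some (some t), t, 0, 0, 0, 0, d, h, 0, found, orig⟩, inp, tri,
        r.map some ++ none :: encTagged L, lam.map some, piv.map some, [], [],
        some t :: aux, cntS, cntC, out⟩
      (fun _ _ _ _ => rfl) (fun _ _ _ _ => rfl) hr hlam hpiv rfl rfl rfl rfl rfl
    rw [zip3_snd (by omega) (by omega)] at key
    rw [encTagged_cons]
    refine (exec_each_step rfl (.seq (.ops_to (by rfl)) (.seq key (.ops_to (by rfl))))
      (ih hL (none :: ((elimRow lam piv (h :: r)).map some).reverse ++ some t :: aux))).cast ?_ ?_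
    · simp [encTagged_cons]
    · simp only [List.length_cons]; ring_nf; omega

/-- Tables whose rows have lengths `n, n - 1, …, 1`. -/
def IsTri : ℕ → List (List (ZMod 2)) → Prop
  | 0, T => T = []
  | n + 1, T => ∃ r T', T = r :: T' ∧ r.length = n + 1 ∧ IsTri n T'

/-- Add the product of the linear forms `m` and `l` to a triangular table. -/
def addProd : List (List (ZMod 2)) → List (ZMod 2) → List (ZMod 2) → List (List (ZMod 2))
  | r :: T, a :: m, b :: l =>
    ((r.headI + a * b) :: zip3 (fun x y z => x + a * y + b * z) r.tail l m) :: addProd T m l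
  | _, _, _ => []

/-- Add the product of the forms on `piv` and `lam` to the table on `tri`, and move it to `aux`. -/
def addTable : Cmd :=
  each isVal .lam (.seq
    (.ops [.load fun r => { r with b := r.x }, .pop .piv fun r o => { r with a := val o },
      .pop .tri fun r o => { r with x := val o }, .push .aux fun r => some (r.x + r.a * r.b)])
    (.seq (zipRow .tri (fun r => r.x + r.a * r.y + r.b * r.z) fun r => r.y)
    (.ops [.load fun r => { r with a := 0, b := 0 }])))

/-- Every round removes the heads of `lam` and `piv`, so the shortened forms match the next, shorter
row of the triangle. Both stacks end empty, ready for the next variable. -/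
theorem exec_addTable {n : ℕ} {T : List (List (ZMod 2))} (hT : IsTri n T)
    (d : ZMod 2) (found orig : Bool) {lam piv : List (ZMod 2)} (hlam : lam.length = n)
    (hpiv : piv.length = n) (inp lin aux cntS cntC : List Sym) (out : List Bool) :
    Exec addTable
      ⟨.main d found orig, inp, encTable T, lin, lam.map some, piv.map some, [], [], aux,
        cntS, cntC, out⟩
      ⟨.main d found orig, inp, [], lin, [], [], [], [],
        (encTable (addProd T piv lam)).reverse ++ aux, cntS, cntC, out⟩
      (n * (9 * n + 11) + 2) := by
  induction n generalizing T lam piv aux with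
  | zero =>
    obtain rfl : lam = [] := by simpa using hlam
    obtain rfl : piv = [] := by simpa using hpiv
    obtain rfl : T = [] := hT
    exact (exec_each_stop _ rfl).cast rfl (by simp)
  | succ n ih =>
    obtain ⟨r, T, rfl, hr, hT⟩ := hT
    obtain _ | ⟨h, r⟩ := r
    · simp at hr
    obtain _ | ⟨b, lam⟩ := lam
    · simp at hlam
    obtain _ | ⟨a, piv⟩ := piv
    · simp at hpiv
    simp only [List.length_cons, Nat.add_right_cancel_iff] at hr hlam hpiv
    have key := exec_zipRow (k := .tri) (.inl rfl) (f := fun r => r.x + r.a * r.y + r.b * r.z)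
      (f' := fun r => r.y) (g := fun x y z => x + a * y + b * z) (g' := fun _ y _ => y)
      ⟨⟨some (some b), h, 0, 0, a, b, d, 0, 0, found, orig⟩, inp,
        r.map some ++ none :: encTable T, lin, lam.map some, piv.map some, [], [],
        some (h + a * b) :: aux, cntS, cntC, out⟩
      (fun _ _ _ _ => rfl) (fun _ _ _ _ => rfl) hr hlam hpiv rfl rfl rfl rfl rfl
    rw [zip3_snd (by omega) (by omega)] at key
    rw [encTable_cons]
    refine (exec_each_step rfl (.seq (.ops_to (by rfl)) (.seq key (.ops_to (by rfl))))
      (ih hT hlam hpiv (none :: ((zip3 (fun x y z => x + a * y + b * z) r lam piv).map some).reverse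
        ++ some (h + a * b) :: aux))).cast ?_ ?_
    · simp [encTable_cons, addProd]
    · ring_nf; omega

/-- Split a row on `tri` into the row on `piv`, with `d` added to its last entry, and a zero row
on `lam`. -/
def firstRow : Cmd :=
  .seq (each isVal .tri (.ops [.push .pivTmp fun r => some r.x, .push .lam fun _ => some 0]))
  (.seq (.ops [.pop .pivTmp fun r o => { r with x := val o }, .push .pivTmp fun r => some (r.x + r.d),
    .load fun r => { r with d := 0 }])
  (move .pivTmp .piv))

theorem exec_firstRow_loop (u : List (ZMod 2)) (r : Reg) (inp rest lin lam piv lamTmp pivTmp aux cntS cntC : List Sym)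
    (out : List Bool) :
    Exec (each isVal .tri (.ops [.push .pivTmp fun r => some r.x, .push .lam fun _ => some 0]))
      ⟨r, inp, u.map some ++ none :: rest, lin, lam, piv, lamTmp, pivTmp, aux, cntS, cntC, out⟩
      ⟨{ r with top := some none, x := 0 }, inp, rest, lin, List.replicate u.length (some 0) ++ lam, piv,
        lamTmp, (u.map some).reverse ++ pivTmp, aux, cntS, cntC, out⟩ (3 * u.length + 2) := by
  induction u generalizing r lam pivTmp with
  | nil => exact (exec_each_stop _ rfl).cast rfl (by simp)
  | cons x u ih =>
    refine (exec_each_step (t := 1) rfl (.ops_to (by rfl))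
      (ih { r with top := some (some x), x := x } (some 0 :: lam) (some x :: pivTmp))).cast ?_ ?_
    · simp [List.replicate_succ']
    · simp only [List.length_cons]; omega

/-- This extracts the cofactor m of the eliminated variable x: the coefficient `d` of x² = x joins
the constant term `y`, which is the last entry. The zero row on `lam` is the default when no pivot
is found. -/
theorem exec_firstRow (u : List (ZMod 2)) (y d : ZMod 2) (r : Reg) (inp rest lin aux cntS cntC : List Sym)
    (out : List Bool) :
    Exec firstRow
      ⟨{ r with d := d }, inp, (u ++ [y]).map some ++ none :: rest, lin, [], [], [], [], aux,
        cntS, cntC, out⟩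
      ⟨{ r with top := none, x := 0, d := 0 }, inp, rest, lin,
        (List.replicate (u.length + 1) 0).map some, (u ++ [y + d]).map some, [], [], aux,
        cntS, cntC, out⟩ (6 * u.length + 11) := by
  have h := exec_firstRow_loop (u ++ [y]) { r with d := d } inp rest lin [] [] [] [] aux cntS cntC out
  have e : ((u ++ [y]).map some).reverse ++ [] = some y :: (u.map some).reverse := by simp
  rw [e] at h
  refine (Exec.seq h (.seq (.ops_to (by rfl)) (exec_move (by decide)
    ⟨{ r with top := some none, x := y, d := 0 }, inp, rest, lin,
      List.replicate (u ++ [y]).length (some 0) ++ [], [], [],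
      some (y + d) :: (u.map some).reverse, aux, cntS, cntC, out⟩))).cast ?_ ?_
  · simp [State.set, State.get, State.setReg]
  · simp [State.get]; omega

/-- Append the row on `piv`, or a zero row if `found` holds, with tag `1` to `aux`. -/
def newRow : Cmd :=
  .seq (.ops [.push .aux fun _ => some 1])
  (.seq (each isVal .piv (.ops [.push .aux fun r => some (if r.found then 0 else r.x),
    .push .pivTmp fun r => some r.x]))
  (.seq (.ops [.push .aux fun _ => none]) (move .pivTmp .piv)))

theorem exec_newRow_loop (u : List (ZMod 2)) (r : Reg) (inp tri lin lam lamTmp pivTmp aux cntS cntC : List Sym)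
    (out : List Bool) :
    Exec (each isVal .piv (.ops [.push .aux fun r => some (if r.found then 0 else r.x),
        .push .pivTmp fun r => some r.x]))
      ⟨r, inp, tri, lin, lam, u.map some, lamTmp, pivTmp, aux, cntS, cntC, out⟩
      ⟨{ r with top := none, x := 0 }, inp, tri, lin, lam, [],
        lamTmp, (u.map some).reverse ++ pivTmp,
        ((u.map fun x => if r.found then 0 else x).map some).reverse ++ aux, cntS, cntC, out⟩
      (3 * u.length + 2) := by
  induction u generalizing r aux pivTmp with
  | nil => exact (exec_each_stop _ rfl).cast rfl (by simp)
  | cons x u ih =>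
    refine (exec_each_step (t := 1) rfl (.ops_to (by rfl))
      (ih { r with top := some (some x), x := x } (some x :: pivTmp)
        (some (if r.found then 0 else x) :: aux))).cast ?_ ?_
    · simp
    · simp only [List.length_cons]; omega

theorem exec_newRow (u : List (ZMod 2)) (r : Reg) (inp tri lin lam aux cntS cntC : List Sym)
    (out : List Bool) :
    Exec newRow
      ⟨r, inp, tri, lin, lam, u.map some, [], [], aux, cntS, cntC, out⟩
      ⟨{ r with top := none, x := 0 }, inp, tri, lin, lam, u.map some, [], [],
        (encTagged [(1, u.map fun x => if r.found then 0 else x)]).reverse ++ aux, cntS, cntC, out⟩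
      (6 * u.length + 6) := by
  refine (Exec.seq (.ops_to (by rfl))
    (.seq (exec_newRow_loop u r inp tri lin lam [] [] (some 1 :: aux) cntS cntC out)
    (.seq (.ops_to (by rfl)) (exec_move (by decide) _)))).cast ?_ ?_
  · simp [State.set, State.get, State.setReg, Op.apply, encTagged, encRow]
  · simp [State.set, State.get, Op.apply]; omega

/-! ### Elimination of a variable -/

/-- The bilinear pairing of two rows. -/
def dot : List (ZMod 2) → List (ZMod 2) → ZMod 2
  | a :: l, x :: xs => a * x + dot l xs
  | _, _ => 0

@[simp] theorem dot_nil (xs : List (ZMod 2)) : dot [] xs = 0 := by simp [dot]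

@[simp] theorem dot_cons (a x : ZMod 2) (l xs : List (ZMod 2)) :
    dot (a :: l) (x :: xs) = a * x + dot l xs := by simp [dot]

theorem dot_replicate_zero (n : ℕ) (xs : List (ZMod 2)) : dot (List.replicate n 0) xs = 0 := by
  induction n generalizing xs with
  | zero => simp
  | succ n ih => cases xs with
    | nil => simp [List.replicate_succ, dot]
    | cons x xs => simp [List.replicate_succ, ih]

theorem dot_zip3 (a b : ZMod 2) : ∀ {us vs ws xs : List (ZMod 2)}, vs.length = us.length →
    ws.length = us.length →
    dot (zip3 (fun x y z => x + a * y + b * z) us vs ws) xs =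
      dot us xs + a * dot vs xs + b * dot ws xs
  | [], [], [], xs, _, _ => by simp [zip3]
  | u :: us, v :: vs, w :: ws, [], _, _ => by simp [zip3, dot]
  | u :: us, v :: vs, w :: ws, x :: xs, h, h' => by
    simp only [List.length_cons, Nat.add_right_cancel_iff] at h h'
    simp only [zip3, dot_cons, dot_zip3 a b h h']
    ring

/-- The last entry of a form is multiplied by the last coordinate, which is 1. -/
theorem dot_append_add (u : List (ZMod 2)) (y d : ZMod 2) {xs : List (ZMod 2)}
    (hx : xs.length = u.length + 1) (hl : xs.getLast? = some 1) :
    dot (u ++ [y + d]) xs = dot (u ++ [y]) xs + d := by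
  induction u generalizing xs with
  | nil =>
    obtain ⟨x, rfl⟩ := List.length_eq_one_iff.1 hx
    obtain rfl : x = 1 := by simpa using hl
    simp
  | cons a u ih =>
    obtain _ | ⟨x, xs⟩ := xs
    · simp at hx
    simp only [List.length_cons, Nat.add_right_cancel_iff] at hx
    rw [List.getLast?_cons_of_ne_nil (by rintro rfl; simp at hx)] at hl
    simp only [List.cons_append, dot_cons, ih hx hl]
    ring

/-- The quadratic form of a triangular table. -/
def evalTable : List (List (ZMod 2)) → List (ZMod 2) → ZMod 2
  | r :: T, x :: xs => x * (r.headI + dot r.tail xs) + evalTable T xs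
  | _, _ => 0

theorem mul_self_eq (x : ZMod 2) : x * x = x := by revert x; decide

/-- By x² = x, (a·x + m)(b·x + l) = x·(ab + a·l + b·m) + m·l; the first term changes the first row,
and m·l is left to the recursion. -/
theorem evalTable_addProd {n : ℕ} {T : List (List (ZMod 2))} (hT : IsTri n T)
    {m l xs : List (ZMod 2)} (hm : m.length = n) (hl : l.length = n) (hx : xs.length = n) :
    evalTable (addProd T m l) xs = evalTable T xs + dot m xs * dot l xs := by
  induction n generalizing T m l xs with
  | zero =>
    obtain rfl : m = [] := by simpa using hm
    obtain rfl : T = [] := hT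
    simp [addProd, evalTable]
  | succ n ih =>
    obtain ⟨r, T, rfl, hr, hT⟩ := hT
    obtain _ | ⟨h, r⟩ := r
    · simp at hr
    obtain _ | ⟨a, m⟩ := m
    · simp at hm
    obtain _ | ⟨b, l⟩ := l
    · simp at hl
    obtain _ | ⟨x, xs⟩ := xs
    · simp at hx
    simp only [List.length_cons, Nat.add_right_cancel_iff] at hr hl hm hx
    simp only [addProd, evalTable, List.headI_cons, List.tail_cons, ih hT hm hl hx, dot_cons,
      dot_zip3 a b (show l.length = r.length by omega) (show m.length = r.length by omega)]
    linear_combination (-(a * b)) * mul_self_eq x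

/-! ### Sums over the affine cube -/

/-- Sum over all points `x` of the affine cube, given by the lists of coordinates followed by
a coordinate `1`. -/
def cubeSum : ℕ → (List (ZMod 2) → ℤ) → ℤ
  | 0, f => f [1]
  | n + 1, f => cubeSum n (fun xs => f (0 :: xs)) + cubeSum n fun xs => f (1 :: xs)

theorem cubeSum_congr {n : ℕ} {f g : List (ZMod 2) → ℤ}
    (h : ∀ xs : List (ZMod 2), xs.length = n + 1 → xs.getLast? = some 1 → f xs = g xs) :
    cubeSum n f = cubeSum n g := by
  induction n generalizing f g with
  | zero => exact h [1] rfl rfl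
  | succ n ih =>
    have h' : ∀ x : ZMod 2, cubeSum n (fun xs => f (x :: xs)) = cubeSum n fun xs => g (x :: xs) := by
      refine fun x => ih fun xs hx hl => h _ (by simp [hx]) ?_
      rw [List.getLast?_cons_of_ne_nil (by rintro rfl; simp at hx), hl]
    simp only [cubeSum, h']

theorem cubeSum_add (n : ℕ) (f g : List (ZMod 2) → ℤ) :
    cubeSum n (fun xs => f xs + g xs) = cubeSum n f + cubeSum n g := by
  induction n generalizing f g with
  | zero => rfl
  | succ n ih => simp only [cubeSum, ih]; ring

theorem cubeSum_const_mul (n : ℕ) (c : ℤ) (f : List (ZMod 2) → ℤ) :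
    cubeSum n (fun xs => c * f xs) = c * cubeSum n f := by
  induction n generalizing f with
  | zero => rfl
  | succ n ih => simp only [cubeSum, ih]; ring

theorem eq_zero_or_one (x : ZMod 2) : x = 0 ∨ x = 1 := by revert x; decide

/-- Shifted order of summation over the first coordinate. -/
theorem cubeSum_succ (n : ℕ) (v : List (ZMod 2) → ZMod 2) (f : List (ZMod 2) → ℤ) :
    cubeSum (n + 1) f = cubeSum n fun xs => f (v xs :: xs) + f ((1 + v xs) :: xs) := by
  rw [cubeSum, ← cubeSum_add]
  refine cubeSum_congr fun xs _ _ => ?_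
  rcases eq_zero_or_one (v xs) with h | h
  · simp [h]
  · rw [h, show (1 : ZMod 2) + 1 = 0 from rfl, add_comm]

/-- The point satisfies the linear equations. -/
def Sat (R : List (List (ZMod 2))) (xs : List (ZMod 2)) : Prop := ∀ r ∈ R, dot r xs = 0

instance (R : List (List (ZMod 2))) (xs : List (ZMod 2)) : Decidable (Sat R xs) :=
  inferInstanceAs (Decidable (∀ r ∈ R, dot r xs = 0))

/-- The nontrivial character of the field with two elements. -/
def sign (a : ZMod 2) : ℤ := if a = 0 then 1 else -1

theorem sign_add (a b : ZMod 2) : sign (a + b) = sign a * sign b := by revert a b; decide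

/-- The number of solutions of a linear system. -/
def linSum (n : ℕ) (R : List (List (ZMod 2))) : ℤ := cubeSum n fun xs => if Sat R xs then 1 else 0

/-- The exponential sum of a quadratic form over the solutions of a linear system. -/
def expSum (n : ℕ) (T R : List (List (ZMod 2))) : ℤ :=
  cubeSum n fun xs => if Sat R xs then sign (evalTable T xs) else 0

/-! ### Effect of eliminating one variable on the two sums -/

section Step

variable {n : ℕ} {R : List (List (ZMod 2))} {lam m xs : List (ZMod 2)}

/-- Elimination adds `r.headI` times `lam` to the tail, and twice that vanishes. The correction term
is zero both at x = λ(xs) and for rows with head 0, the two cases used next. -/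
theorem dot_elimRow {r : List (ZMod 2)} (hr : r.length = n + 1) (hlam : lam.length = n)
    (hm : m.length = n) (x : ZMod 2) (xs : List (ZMod 2)) :
    dot r (x :: xs) = dot (elimRow lam m r) xs + r.headI * (x + dot lam xs) := by
  obtain _ | ⟨h, r⟩ := r
  · simp at hr
  replace hr : r.length = n := by simpa using hr
  have e := dot_zip3 h 0 (us := r) (vs := lam) (ws := m) (xs := xs) (by omega) (by omega)
  simp only [zero_mul, add_zero] at e
  simp only [elimRow, List.headI_cons, List.tail_cons, dot_cons, e]
  have : (2 : ZMod 2) = 0 := rfl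
  linear_combination (-(h * dot lam xs)) * this

theorem sat_elim_cons (hR : ∀ r ∈ R, r.length = n + 1) (hlam : lam.length = n)
    (hm : m.length = n) : Sat R (dot lam xs :: xs) ↔ Sat (R.map (elimRow lam m)) xs := by
  simp only [Sat, List.forall_mem_map]
  refine forall₂_congr fun r hr => ?_
  rw [dot_elimRow (hR r hr) hlam hm, CharTwo.add_self_eq_zero, mul_zero, add_zero]

theorem sat_cons_of_heads (hR : ∀ r ∈ R, r.length = n + 1) (hlam : lam.length = n)
    (hm : m.length = n) (h0 : ∀ r ∈ R, r.headI = 0) (x : ZMod 2) :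
    Sat R (x :: xs) ↔ Sat (R.map (elimRow lam m)) xs := by
  simp only [Sat, List.forall_mem_map]
  refine forall₂_congr fun r hr => ?_
  rw [dot_elimRow (hR r hr) hlam hm, h0 r hr, zero_mul, add_zero]

theorem not_sat_cons (hp : (1 :: lam) ∈ R) : ¬ Sat R ((1 + dot lam xs) :: xs) := by
  intro h
  have := h _ hp
  rw [dot_cons, one_mul, add_assoc, CharTwo.add_self_eq_zero, add_zero] at this
  exact one_ne_zero this

theorem linSum_of_pivot (hR : ∀ r ∈ R, r.length = n + 2) (hlam : lam.length = n + 1)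
    (hm : m.length = n + 1) (hp : (1 :: lam) ∈ R) :
    linSum (n + 1) R = linSum n (R.map (elimRow lam m)) := by
  rw [linSum, cubeSum_succ n (dot lam)]
  refine cubeSum_congr fun xs _ _ => ?_
  simp only [sat_elim_cons hR hlam hm, not_sat_cons hp, if_false, add_zero]

/-- The variable is free, so both of its values count. It matters that `lam` is arbitrary: the pivot
may come from a derived row, which does not belong to this system. -/
theorem linSum_of_heads (hR : ∀ r ∈ R, r.length = n + 2) (hlam : lam.length = n + 1)
    (hm : m.length = n + 1) (h0 : ∀ r ∈ R, r.headI = 0) :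
    linSum (n + 1) R = 2 * linSum n (R.map (elimRow lam m)) := by
  rw [linSum, cubeSum_succ n (dot lam), linSum, ← cubeSum_const_mul]
  refine cubeSum_congr fun xs _ _ => ?_
  simp only [sat_cons_of_heads hR hlam hm h0]
  ring

variable {T : List (List (ZMod 2))} {u : List (ZMod 2)} {d y : ZMod 2}

theorem evalTable_cons (hu : u.length = n) (hx : xs.length = n + 1)
    (hl : xs.getLast? = some 1) (x : ZMod 2) :
    evalTable ((d :: (u ++ [y])) :: T) (x :: xs) = x * dot (u ++ [y + d]) xs + evalTable T xs := by
  rw [dot_append_add u y d (by omega) hl, evalTable, List.headI_cons, List.tail_cons]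
  ring

/-- Only x = λ(xs) survives the pivot equation, and there x·m + q' equals q' + m·λ. -/
theorem expSum_of_pivot (hR : ∀ r ∈ R, r.length = n + 2) (hlam : lam.length = n + 1)
    (hu : u.length = n) (hT : IsTri (n + 1) T) (hp : (1 :: lam) ∈ R) :
    expSum (n + 1) ((d :: (u ++ [y])) :: T) R =
      expSum n (addProd T (u ++ [y + d]) lam) (R.map (elimRow lam (u ++ [y + d]))) := by
  rw [expSum, cubeSum_succ n (dot lam)]
  refine cubeSum_congr fun xs hx hl => ?_
  simp only [sat_elim_cons hR hlam (show (u ++ [y + d]).length = n + 1 by simp [hu]),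
    not_sat_cons hp, if_false, add_zero]
  rw [evalTable_cons hu hx hl, evalTable_addProd hT (by simp [hu]) hlam hx, mul_comm (dot lam xs),
    add_comm (evalTable T xs)]

/-- The equations do not involve x, so summing over x leaves (-1)^q'·(1 + (-1)^m), which is
2·(-1)^q' where m = 0 and 0 elsewhere. As λ = 0, `addProd` does not change the value of the table.
-/
theorem expSum_of_heads (hR : ∀ r ∈ R, r.length = n + 2) (hlam : lam = List.replicate (n + 1) 0)
    (hu : u.length = n) (hT : IsTri (n + 1) T) (h0 : ∀ r ∈ R, r.headI = 0) :
    expSum (n + 1) ((d :: (u ++ [y])) :: T) R =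
      2 * expSum n (addProd T (u ++ [y + d]) lam)
        (R.map (elimRow lam (u ++ [y + d])) ++ [u ++ [y + d]]) := by
  have hlam' : lam.length = n + 1 := by simp [hlam]
  have hm : (u ++ [y + d]).length = n + 1 := by simp [hu]
  rw [expSum, cubeSum_succ n (dot lam), expSum, ← cubeSum_const_mul]
  refine cubeSum_congr fun xs hx hl => ?_
  simp only [sat_cons_of_heads hR hlam' hm h0, evalTable_cons hu hx hl,
    evalTable_addProd hT hm hlam' hx]
  rw [hlam, dot_replicate_zero, ← hlam]
  have hS : Sat (R.map (elimRow lam (u ++ [y + d])) ++ [u ++ [y + d]]) xs ↔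
      Sat (R.map (elimRow lam (u ++ [y + d]))) xs ∧ dot (u ++ [y + d]) xs = 0 := by
    simp [Sat, or_imp, forall_and]
  rw [if_congr hS rfl rfl]
  by_cases h₁ : Sat (R.map (elimRow lam (u ++ [y + d]))) xs
  · rcases eq_zero_or_one (dot (u ++ [y + d]) xs) with h | h
    · simp [h₁, h]; ring
    -- Here m = 1, and the terms for the two values of x cancel.
    · simp [h₁, h, sign_add]
      simp only [sign]
      split_ifs <;> simp_all
  · simp [h₁]

end Step

/-! ### Choice of the pivot row -/

section Pick

variable {L : List (ZMod 2 × List (ZMod 2))}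

theorem pick_true (l : List (ZMod 2)) : pick true L l = l := by
  induction L with
  | nil => rfl
  | cons p L ih => simpa [pick] using ih

theorem pick_of_heads (h : ∀ p ∈ L, p.2.headI = 0) (l : List (ZMod 2)) : pick false L l = l := by
  induction L with
  | nil => rfl
  | cons p L ih =>
    simp only [List.mem_cons, forall_eq_or_imp] at h
    have h1 : (p.2.headI == 1) = false := by rw [h.1]; decide
    rw [pick, h1]
    simpa [h.1] using ih h.2

/-- A pivot in the front part takes precedence. Since `tagged` lists the original rows first, an
original pivot is used whenever there is one. -/
theorem pick_append_mem {L' : List (ZMod 2 × List (ZMod 2))} (h : ∃ p ∈ L, p.2.headI = 1)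
    (l : List (ZMod 2)) : ∃ p ∈ L, p.2.headI = 1 ∧ pick false (L ++ L') l = p.2.tail := by
  induction L with
  | nil => simp at h
  | cons p L ih =>
    by_cases hp : p.2.headI = 1
    · exact ⟨p, by simp, hp, by simp [pick, hp, pick_true]⟩
    · obtain ⟨q, hq, hq'⟩ := ih (by simpa [hp] using h)
      refine ⟨q, by simp [hq], hq'.1, ?_⟩
      have h1 : (p.2.headI == 1) = false := beq_eq_false_iff_ne.2 hp
      rw [← hq'.2]
      simp [pick, hp, h1]

end Pick

/-! ### The combined system of original and derived equations -/

/-- The list of tagged rows: rows of the input system have tag `0`, derived rows tag `1`. -/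
def tagged (A B : List (List (ZMod 2))) : List (ZMod 2 × List (ZMod 2)) :=
  A.map (fun r => (0, r)) ++ B.map fun r => (1, r)

/-- Is there a row with head `1`? -/
def hasPivot (L : List (ZMod 2 × List (ZMod 2))) : Bool := L.any fun p => p.2.headI == 1

/-- Is there a row with head `1` and tag `0`? -/
def hasOrigPivot (L : List (ZMod 2 × List (ZMod 2))) : Bool :=
  L.any fun p => p.2.headI == 1 && p.1 == 0

/-- The tagged rows after elimination of a variable. -/
def elimRows (L : List (ZMod 2 × List (ZMod 2))) (lam m : List (ZMod 2)) :
    List (ZMod 2 × List (ZMod 2)) :=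
  L.map (fun p => (p.1, elimRow lam m p.2)) ++
    [(1, m.map fun x => if hasPivot L = true then 0 else x)]

theorem hasPivot_of_hasOrigPivot {L : List (ZMod 2 × List (ZMod 2))} (h : hasOrigPivot L = true) :
    hasPivot L = true := by
  simp only [hasOrigPivot, hasPivot, List.any_eq_true, Bool.and_eq_true] at h ⊢
  obtain ⟨p, hp, h, -⟩ := h
  exact ⟨p, hp, h⟩

theorem sat_append_map_zero (R : List (List (ZMod 2))) (m xs : List (ZMod 2)) :
    Sat (R ++ [m.map fun _ => 0]) xs ↔ Sat R xs := by
  simp [Sat, or_imp, forall_and, List.map_const', dot_replicate_zero]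

/-- The effect of the elimination of a variable on the two sums. -/
theorem sums_elim {n : ℕ} {A B T : List (List (ZMod 2))} {lam u : List (ZMod 2)} {y d : ZMod 2}
    (hA : ∀ r ∈ A, r.length = n + 2) (hB : ∀ r ∈ B, r.length = n + 2) (hu : u.length = n)
    (hT : IsTri (n + 1) T) (hlam : lam = pick false (tagged A B) (List.replicate (n + 1) 0)) :
    ∃ A' B', elimRows (tagged A B) lam (u ++ [y + d]) = tagged A' B' ∧
      A'.length = A.length ∧ B'.length = B.length + 1 ∧
      (∀ r ∈ A', r.length = n + 1) ∧ (∀ r ∈ B', r.length = n + 1) ∧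
      linSum (n + 1) A = (if hasOrigPivot (tagged A B) = true then 1 else 2) * linSum n A' ∧
      expSum (n + 1) ((d :: (u ++ [y])) :: T) (A ++ B) =
        (if hasPivot (tagged A B) = true then 1 else 2) *
          expSum n (addProd T (u ++ [y + d]) lam) (A' ++ B') := by
  have hAB : ∀ r ∈ A ++ B, r.length = n + 2 := by
    simp only [List.mem_append]
    rintro r (h | h)
    exacts [hA r h, hB r h]
  have hm : (u ++ [y + d]).length = n + 1 := by simp [hu]
  have htag : ∀ p ∈ tagged A B, p.2 ∈ A ++ B := by
    simp only [tagged, List.mem_append, List.mem_map]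
    rintro p (⟨r, h, rfl⟩ | ⟨r, h, rfl⟩)
    exacts [.inl h, .inr h]
  have hlen : lam.length = n + 1 := by
    rw [hlam]
    exact length_pick (fun p hp => hAB _ (htag p hp)) _ (by simp)
  have cons_mem : ∀ {C : List (List (ZMod 2))} {r : List (ZMod 2)}, r.length = n + 2 → r ∈ C →
      r.headI = 1 → lam = r.tail → 1 :: lam ∈ C := by
    rintro C (_ | ⟨h, r⟩) hr hC h1 rfl
    · simp at hr
    · obtain rfl : h = 1 := h1
      exact hC
  have helim : ∀ {r : List (ZMod 2)}, r.length = n + 2 →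
      (elimRow lam (u ++ [y + d]) r).length = n + 1 := by
    intro r hr
    have : r.tail.length = n + 1 := by simp [hr]
    rw [elimRow, length_zip3 _ (by omega) (by omega), this]
  refine ⟨A.map (elimRow lam (u ++ [y + d])), B.map (elimRow lam (u ++ [y + d])) ++
    [(u ++ [y + d]).map fun x => if hasPivot (tagged A B) = true then 0 else x], ?_, by simp, by simp, ?_, ?_,
    ?_, ?_⟩
  · simp [elimRows, tagged, Function.comp_def]
  · simp only [List.forall_mem_map]
    exact fun r hr => helim (hA r hr)
  · simp only [List.mem_append, List.mem_map, List.mem_singleton]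
    rintro r (⟨r, hr, rfl⟩ | rfl)
    · exact helim (hB r hr)
    · simp [hu]
  · split_ifs with h
    · rw [one_mul]
      refine linSum_of_pivot hA hlen hm ?_
      simp only [hasOrigPivot, List.any_eq_true, Bool.and_eq_true, beq_iff_eq, tagged,
        List.mem_append, List.mem_map] at h
      obtain ⟨p, ⟨r, hr, rfl⟩ | ⟨r, hr, rfl⟩, h1, h0⟩ := h
      -- Splitting the list at the end of the original rows shows that the chosen pivot lies in `A`,
      -- which elimination inside `A` alone requires.
      · obtain ⟨p, hp, hp1, hp2⟩ := pick_append_mem (L := A.map fun r => ((0 : ZMod 2), r))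
          (L' := B.map fun r => ((1 : ZMod 2), r)) ⟨_, List.mem_map_of_mem hr, h1⟩
          (List.replicate (n + 1) 0)
        obtain ⟨r', hr', rfl⟩ := List.mem_map.1 hp
        exact cons_mem (hA r' hr') hr' hp1 (hlam.trans hp2)
      · exact absurd h0 one_ne_zero
    -- `lam` may be a derived pivot here, but rows of `A` with head 0 are not affected by it.
    · refine linSum_of_heads hA hlen hm fun r hr => ?_
      refine (eq_zero_or_one _).resolve_right fun h1 => h ?_
      simp only [hasOrigPivot, List.any_eq_true, Bool.and_eq_true, beq_iff_eq]
      exact ⟨(0, r), by simp [tagged, hr], h1, rfl⟩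
  · split_ifs with h
    · rw [one_mul, ← List.append_assoc, ← List.map_append]
      -- With a pivot, the appended row is zero and imposes no condition.
      have e : expSum n (addProd T (u ++ [y + d]) lam)
          ((A ++ B).map (elimRow lam (u ++ [y + d])) ++ [(u ++ [y + d]).map fun _ => 0]) =
          expSum n (addProd T (u ++ [y + d]) lam) ((A ++ B).map (elimRow lam (u ++ [y + d]))) :=
        cubeSum_congr fun xs _ _ => if_congr (sat_append_map_zero _ _ _) rfl rfl
      rw [e]
      refine expSum_of_pivot hAB hlen hu hT ?_
      simp only [hasPivot, List.any_eq_true, beq_iff_eq] at h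
      obtain ⟨p, hp, hp1, hp2⟩ := pick_append_mem (L' := []) h (List.replicate (n + 1) 0)
      rw [List.append_nil] at hp2
      exact cons_mem (hAB _ (htag p hp)) (htag p hp) hp1 (hlam.trans hp2)
    · rw [← List.append_assoc, ← List.map_append, List.map_id']
      have h0 : ∀ p ∈ tagged A B, p.2.headI = 0 := fun p hp =>
        (eq_zero_or_one _).resolve_right fun h1 => h (by
          simp only [hasPivot, List.any_eq_true, beq_iff_eq]
          exact ⟨p, hp, h1⟩)
      refine expSum_of_heads hAB (hlam.trans (pick_of_heads h0 _)) hu hT fun r hr => ?_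
      rcases List.mem_append.1 hr with hr | hr
      · exact h0 (0, r) (by simp [tagged, hr])
      · exact h0 (1, r) (by simp [tagged, hr])

/-! ### The elimination program -/

/-- The elimination of one variable. -/
def elimStep : Cmd :=
  .seq (.ops [.push .tri fun r => some r.x, .load fun r => .main r.d false false])
  (.seq firstRow (.seq scan (.seq (move .aux .lin) (.seq addLam (.seq newRow
  (.seq (move .aux .lin) (.seq addTable (.seq (move .aux .tri)
  (.seq (.ite (fun r => r.found) (.ops []) (.ops [.push .cntC fun _ => some 0]))
  (.seq (.ite (fun r => r.orig) (.ops []) (.ops [.push .cntS fun _ => some 0]))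
  (.ops [.pop .tri fun r o => { r with d := val o }])))))))))))

theorem length_encTable {n : ℕ} {T : List (List (ZMod 2))} (hT : IsTri n T) :
    (encTable T).length ≤ n * (n + 1) := by
  induction n generalizing T with
  | zero => obtain rfl : T = [] := hT; simp [encTable]
  | succ n ih =>
    obtain ⟨r, T, rfl, hr, hT⟩ := hT
    rw [encTable_cons]
    have := ih hT
    simp only [List.length_append, List.length_map, List.length_cons, hr]
    nlinarith

theorem isTri_addProd {n : ℕ} {T : List (List (ZMod 2))} (hT : IsTri n T) {m l : List (ZMod 2)}
    (hm : m.length = n) (hl : l.length = n) : IsTri n (addProd T m l) := by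
  induction n generalizing T m l with
  | zero =>
    obtain rfl : T = [] := hT
    simp [addProd, IsTri]
  | succ n ih =>
    obtain ⟨r, T, rfl, hr, hT⟩ := hT
    obtain _ | ⟨a, m⟩ := m
    · simp at hm
    obtain _ | ⟨b, l⟩ := l
    · simp at hl
    simp only [List.length_cons, Nat.add_right_cancel_iff] at hm hl
    have hr' : r.tail.length = n := by simp [hr]
    exact ⟨_, _, rfl, by rw [List.length_cons, length_zip3 _ (by omega) (by omega), hr'], ih hT hm hl⟩

/-- Record a step in unary unless `b` holds. -/
def count (b : Bool) (l : List Sym) : List Sym := if b then l else some 0 :: l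

/-- Between rounds the head of the table is kept in register `d` instead of on `tri`. The loop has
moreover popped the next entry `x` for its test, so the step first pushes `x` back, and it ends by
popping the head `d'` of the new table. The constant 100 is generous. -/
theorem exec_elimStep {n : ℕ} {T : List (List (ZMod 2))} (hT : IsTri (n + 1) T)
    {u : List (ZMod 2)} (hu : u.length = n) (y d : ZMod 2) {x : ZMod 2} {v : List (ZMod 2)}
    (hv : u ++ [y] = x :: v) {L : List (ZMod 2 × List (ZMod 2))}
    (hL : ∀ p ∈ L, p.2.length = n + 2) (found orig : Bool) (inp cntS cntC : List Sym)
    (out : List Bool) {lam : List (ZMod 2)} (hlam : lam = pick false L (List.replicate (n + 1) 0))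
    {d' : ZMod 2} {r : List (ZMod 2)} {T' : List (List (ZMod 2))}
    (hd : addProd T (u ++ [y + d]) lam = (d' :: r) :: T') {K : ℕ} (hn : n ≤ K) (hK : L.length ≤ K) :
    Exec elimStep
      ⟨{ Reg.main d found orig with top := some (some x), x := x }, inp,
        v.map some ++ none :: encTable T, encTagged L, [], [], [], [], [], cntS, cntC, out⟩
      ⟨.main d' (hasPivot L) (hasOrigPivot L), inp, r.map some ++ none :: encTable T',
        encTagged (elimRows L lam (u ++ [y + d])), [], [], [], [], [],
        count (hasOrigPivot L) cntS, count (hasPivot L) cntC, out⟩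
      (100 * (K + 2) ^ 2) := by
  have hm : (u ++ [y + d]).length = n + 1 := by simp [hu]
  have hlen : lam.length = n + 1 := by
    rw [hlam]; exact length_pick hL _ (by simp)
  have hL' : ∀ p ∈ L.map (fun p => (p.1, elimRow lam (u ++ [y + d]) p.2)), p.2.length = n + 1 := by
    simp only [List.forall_mem_map]
    intro p hp
    have : p.2.tail.length = n + 1 := by simp [hL p hp]
    rw [elimRow, length_zip3 _ (by omega) (by omega), this]
  have hT' := length_encTable (isTri_addProd hT hm hlen)
  have s₁ := exec_firstRow u y d (.main d false false) inp (encTable T) (encTagged L) [] cntS cntC out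
  have s₂ := exec_scan hL 0 false false (List.length_replicate (n := u.length + 1) (a := (0 : ZMod 2)) |>.trans
    (by rw [hu])) hm inp (encTable T) [] cntS cntC out
  have l₁ := length_encTagged_le L hL
  have l₂ := length_encTagged_le _ hL'
  rw [List.length_map] at l₂
  rw [hu, ← hlam] at s₂
  have s₄ := exec_addLam hL 0 (hasPivot L) (hasOrigPivot L) hlen hm inp (encTable T) [] cntS cntC out
  have s₅ := exec_newRow (u ++ [y + d]) (.main 0 (hasPivot L) (hasOrigPivot L)) inp (encTable T) []
    (lam.map some)
    ((encTagged (L.map fun p => (p.1, elimRow lam (u ++ [y + d]) p.2))).reverse ++ []) cntS cntC out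
  have s₇ := exec_addTable hT 0 (hasPivot L) (hasOrigPivot L) hlen hm inp
    (encTagged (elimRows L lam (u ++ [y + d]))) [] cntS cntC out
  have c₁ : Exec (.ite (fun r => r.found) (.ops []) (.ops [.push .cntC fun _ => some 0]))
      ⟨.main 0 (hasPivot L) (hasOrigPivot L), inp, (d' :: r).map some ++ none :: encTable T',
        encTagged (elimRows L lam (u ++ [y + d])), [], [], [], [], [], cntS, cntC, out⟩
      ⟨.main 0 (hasPivot L) (hasOrigPivot L), inp, (d' :: r).map some ++ none :: encTable T',
        encTagged (elimRows L lam (u ++ [y + d])), [], [], [], [], [], cntS,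
        count (hasPivot L) cntC, out⟩ 2 := by
    cases hasPivot L
    · exact .ite_false rfl (.ops_to rfl)
    · exact .ite_true rfl (.ops_to rfl)
  have c₂ : Exec (.ite (fun r => r.orig) (.ops []) (.ops [.push .cntS fun _ => some 0]))
      ⟨.main 0 (hasPivot L) (hasOrigPivot L), inp, (d' :: r).map some ++ none :: encTable T',
        encTagged (elimRows L lam (u ++ [y + d])), [], [], [], [], [], cntS,
        count (hasPivot L) cntC, out⟩
      ⟨.main 0 (hasPivot L) (hasOrigPivot L), inp, (d' :: r).map some ++ none :: encTable T',
        encTagged (elimRows L lam (u ++ [y + d])), [], [], [], [], [], count (hasOrigPivot L) cntS,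
        count (hasPivot L) cntC, out⟩ 2 := by
    cases hasOrigPivot L
    · exact .ite_false rfl (.ops_to rfl)
    · exact .ite_true rfl (.ops_to rfl)
  have m₁ := exec_move (k := .aux) (k' := .lin) (by decide)
    ⟨.main 0 (hasPivot L) (hasOrigPivot L), inp, encTable T, [], lam.map some,
      (u ++ [y + d]).map some, [], [], (encTagged L).reverse ++ [], cntS, cntC, out⟩
  have m₂ := exec_move (k := .aux) (k' := .lin) (by decide)
    ⟨.main 0 (hasPivot L) (hasOrigPivot L), inp, encTable T, [], lam.map some,
      (u ++ [y + d]).map some, [], [],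
      (encTagged [(1, (u ++ [y + d]).map fun x => if hasPivot L = true then 0 else x)]).reverse ++
        ((encTagged (L.map fun p => (p.1, elimRow lam (u ++ [y + d]) p.2))).reverse ++ []),
      cntS, cntC, out⟩
  have m₃ := exec_move (k := .aux) (k' := .tri) (by decide)
    ⟨.main 0 (hasPivot L) (hasOrigPivot L), inp, [], encTagged (elimRows L lam (u ++ [y + d])),
      [], [], [], [], (encTable (addProd T (u ++ [y + d]) lam)).reverse ++ [], cntS, cntC, out⟩
  rw [hd, encTable_cons] at m₃
  rw [hd, encTable_cons] at s₇ hT'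
  rw [hv, hu] at s₁
  simp only [State.get, State.set, State.setReg, List.append_nil, List.reverse_append,
    List.reverse_reverse, List.length_append, List.length_reverse] at m₁ m₂ m₃ s₂ s₄ s₅ s₇
  have e : encTagged (L.map fun p => (p.1, elimRow lam (u ++ [y + d]) p.2)) ++
      encTagged [(1, (u ++ [y + d]).map fun x => if hasPivot L = true then 0 else x)] =
      encTagged (elimRows L lam (u ++ [y + d])) := by
    simp [encTagged, elimRows]
  rw [e] at m₂
  refine (Exec.seq (.ops_to (by rfl)) (.seq s₁ (.seq s₂ (.seq m₁ (.seq s₄ (.seq s₅ (.seq m₂ (.seq s₇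
    (.seq m₃ (.seq c₁ (.seq c₂ (.ops_to (by rfl))))))))))))).mono ?_
  have l₃ : (encTagged [(1, (u ++ [y + d]).map fun x => if hasPivot L = true then 0 else x)]).length
    = n + 3 := by simp [encTagged, encRow, hu]
  rw [l₁, l₂, l₃, hu, List.length_singleton]
  simp only [List.length_append, List.length_cons, List.length_map] at hT' ⊢
  have b₁ : L.length * n ≤ K * K := Nat.mul_le_mul hK hn
  have b₂ : n * n ≤ K * K := Nat.mul_le_mul hn hn
  nlinarith

/-- The number of variables plus the number of rows is constant, since each step removes a variable
and adds a row; so `K` bounds the tables throughout. The inequality `c' ≤ s'` holds because an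
original pivot is a pivot, so whenever E gains a factor 2 so does S. -/
theorem exec_elim {n K : ℕ} {T₁ : List (List (ZMod 2))} {d : ZMod 2} {w : List (ZMod 2)}
    (hT : IsTri (n + 1) ((d :: w) :: T₁)) {A B : List (List (ZMod 2))}
    (hA : ∀ r ∈ A, r.length = n + 1) (hB : ∀ r ∈ B, r.length = n + 1)
    (hK : n + (A.length + B.length) ≤ K) (s c : ℕ) (found orig : Bool) (inp : List Sym)
    (out : List Bool) :
    ∃ s' c' d' f o A' B', Exec (each isVal .tri elimStep)
      ⟨.main d found orig, inp, w.map some ++ none :: encTable T₁, encTagged (tagged A B),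
        [], [], [], [], [], List.replicate s (some 0), List.replicate c (some 0), out⟩
      ⟨{ Reg.main d' f o with top := some none }, inp, [], encTagged (tagged A' B'),
        [], [], [], [], [], List.replicate (s' + s) (some 0), List.replicate (c' + c) (some 0), out⟩
      (n * (100 * (K + 2) ^ 2 + 2) + 2) ∧
      A'.length + B'.length ≤ K ∧ (∀ r ∈ A', r.length = 1) ∧ (∀ r ∈ B', r.length = 1) ∧
      linSum n A = 2 ^ s' * linSum 0 A' ∧
      expSum n ((d :: w) :: T₁) (A ++ B) = 2 ^ c' * expSum 0 [[d']] (A' ++ B') ∧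
      s' ≤ n ∧ c' ≤ s' := by
  induction n generalizing T₁ d w A B s c found orig with
  | zero =>
    obtain ⟨r, T', h, hr, hT'⟩ := hT
    obtain ⟨rfl, rfl⟩ := List.cons_eq_cons.1 h
    obtain rfl : T₁ = [] := hT'
    obtain rfl : w = [] := by simpa using hr
    -- The remaining table is `[[d]]` with its entry already in the register, so the loop reads the
    -- separator and stops.
    refine ⟨0, 0, d, found, orig, A, B, (exec_each_stop _ rfl).cast ?_ (by simp), by omega, hA, hB,
      by simp, by simp, le_rfl, le_rfl⟩
    rw [zero_add, zero_add]
    rfl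
  | succ n ih =>
    obtain ⟨r, T', h, hr, hT'⟩ := hT
    obtain ⟨rfl, rfl⟩ := List.cons_eq_cons.1 h
    replace hr : w.length = n + 1 := by simpa using hr
    have hw : w ≠ [] := by rintro rfl; simp at hr
    obtain ⟨u, y, rfl⟩ : ∃ u y, w = u ++ [y] := ⟨_, _, (List.dropLast_append_getLast hw).symm⟩
    have hu : u.length = n := by simpa using hr
    obtain ⟨x, v, hv⟩ : ∃ x v, u ++ [y] = x :: v := List.exists_cons_of_ne_nil (by simp)
    obtain ⟨A', B', hAB, hA'l, hB'l, hA', hB', hlin, hexp⟩ :=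
      sums_elim (y := y) (d := d) hA hB hu hT' rfl
    have hL : ∀ p ∈ tagged A B, p.2.length = n + 2 := by
      simp only [tagged, List.mem_append, List.mem_map]
      rintro p (⟨r, h, rfl⟩ | ⟨r, h, rfl⟩)
      exacts [hA r h, hB r h]
    generalize hlam : pick false (tagged A B) (List.replicate (n + 1) 0) = lam at *
    have hlen : lam.length = n + 1 := by rw [← hlam]; exact length_pick hL _ (by simp)
    have hT'' := isTri_addProd hT' (show (u ++ [y + d]).length = n + 1 by simp [hu]) hlen
    obtain ⟨w', T'', hd, hw', hT3⟩ := id hT''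
    obtain _ | ⟨d', r⟩ := w'
    · simp at hw'
    have hstep := exec_elimStep hT' hu y d hv hL found orig inp (List.replicate s (some 0))
      (List.replicate c (some 0)) out hlam.symm hd (K := K) (by omega) (by simp [tagged]; omega)
    have hc : ∀ (b : Bool) (k : ℕ), count b (List.replicate k (some 0)) =
        List.replicate ((if b = true then 0 else 1) + k) (some 0) := by
      rintro (_ | _) k
      · simp [count, add_comm 1 k, List.replicate_succ]
      · simp [count]
    rw [hAB, hc, hc] at hstep
    rw [hd] at hT'' hexp
    obtain ⟨s', c', d'', f, o, A'', B'', he, h1, h2, h3, h4, h5, h6, h7⟩ := ih hT'' hA' hB' (by omega)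
      ((if hasOrigPivot (tagged A B) = true then 0 else 1) + s)
      ((if hasPivot (tagged A B) = true then 0 else 1) + c) (hasPivot (tagged A B))
      (hasOrigPivot (tagged A B))
    refine ⟨s' + (if hasOrigPivot (tagged A B) = true then 0 else 1),
      c' + (if hasPivot (tagged A B) = true then 0 else 1), d'', f, o, A'', B'', ?_, h1, h2, h3,
      ?_, ?_, ?_, ?_⟩
    · rw [hv]
      refine (exec_each_step rfl hstep he).cast ?_ ?_
      · simp only [add_assoc]
      · ring_nf; omega
    · rw [hlin, h4]
      split_ifs <;> ring
    · rw [hexp, h5]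
      split_ifs <;> ring
    · split_ifs <;> omega
    · refine add_le_add h7 ?_
      split_ifs with hp ho
      exacts [le_rfl, zero_le_one, (hp (hasPivot_of_hasOrigPivot ‹_›)).elim, le_rfl]

/-! ### Binary output -/

/-- `encodeNat` lists the least significant digit first. Zero is the empty word, so no digit may be
prepended to it. -/
theorem encodeNat_two_mul {n : ℕ} (h : 0 < n) : encodeNat (2 * n) = false :: encodeNat n := by
  obtain ⟨p, hp⟩ : ∃ p, (n : Num) = Num.pos p := by
    cases h' : (n : Num) with
    | zero =>
      have := Num.to_of_nat n
      rw [h'] at this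
      exact absurd this.symm h.ne'
    | pos p => exact ⟨p, rfl⟩
  have : ((2 * n : ℕ) : Num) = Num.pos (.bit0 p) := by
    rw [two_mul, Nat.cast_add, hp]
    exact Num.bit0_of_bit0 (Num.pos p)
  unfold encodeNat
  rw [this, hp]
  rfl

theorem encodeNat_two_mul_add_one (n : ℕ) : encodeNat (2 * n + 1) = true :: encodeNat n := by
  unfold encodeNat
  cases h : (n : Num) with
  | zero =>
    have := Num.to_of_nat n
    rw [h] at this
    obtain rfl : n = 0 := this.symm
    rfl
  | pos p =>
    have : ((2 * n + 1 : ℕ) : Num) = Num.pos (.bit1 p) := by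
      rw [two_mul, Nat.cast_add, Nat.cast_add, h]
      exact Num.bit1_of_bit1 (Num.pos p)
    rw [this]
    rfl

theorem encodeNat_two_pow_mul (k : ℕ) {n : ℕ} (h : 0 < n) :
    encodeNat (2 ^ k * n) = List.replicate k false ++ encodeNat n := by
  induction k with
  | zero => simp
  | succ k ih =>
    rw [pow_succ', mul_assoc, encodeNat_two_mul (by positivity), ih]
    rfl

theorem encodeNat_two_pow (k : ℕ) : encodeNat (2 ^ k) = List.replicate k false ++ [true] := by
  have := encodeNat_two_pow_mul k one_pos
  rwa [mul_one] at this

theorem encodeNat_two_pow_sub_one (k : ℕ) : encodeNat (2 ^ k - 1) = List.replicate k true := by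
  induction k with
  | zero => rfl
  | succ k ih =>
    have : 2 ^ (k + 1) - 1 = 2 * (2 ^ k - 1) + 1 := by
      have := Nat.one_le_two_pow (n := k)
      omega
    rw [this, encodeNat_two_mul_add_one, ih]
    rfl

/-- Empty a stack, writing `b` for each symbol. -/
def emitAll (k : Stack) (b : Bool) : Cmd := each isVal k (.ops [.emit fun _ => b])

/-- Empty a stack. -/
def clear (k : Stack) : Cmd := each isVal k (.ops [])

theorem exec_emitAll {k : Stack} (b : Bool) {n : ℕ} (s : State)
    (h : s.get k = List.replicate n (some 0)) :
    Exec (emitAll k b) s { s.set k [] with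
      reg := { s.reg with top := none, x := 0 }, out := List.replicate n b ++ s.out } (3 * n + 2) := by
  induction n generalizing s with
  | zero =>
    refine (exec_each_stop s ?_).cast ?_ (by simp)
    · simp [State.popped, h, isVal]
    · simp only [State.popped, h]
      cases k <;> rfl
  | succ n ih =>
    rw [List.replicate_succ] at h
    have h₂ := ih ({ s.set k (List.replicate n (some 0)) with
      reg := { s.reg with top := some (some 0), x := 0 }, out := b :: s.out }) (by cases k <;> rfl)
    refine (exec_each_step (t := 1) ?_ (.ops_to ?_) h₂).cast ?_ ?_
    · simp [State.popped, h, isVal]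
    · simp only [State.popped, h]
      cases k <;> rfl
    · rw [List.replicate_succ']
      cases k <;> simp [State.set]
    · omega

theorem exec_clear {k : Stack} {n : ℕ} (s : State) (h : s.get k = List.replicate n (some 0)) :
    Exec (clear k) s ((s.set k []).setReg { s.reg with top := none, x := 0 }) (3 * n + 2) := by
  induction n generalizing s with
  | zero =>
    refine (exec_each_stop s ?_).cast ?_ (by simp)
    · simp [State.popped, h, isVal]
    · simp only [State.popped, h]
      cases k <;> rfl
  | succ n ih =>
    rw [List.replicate_succ] at h
    have h₂ := ih ((s.set k (List.replicate n (some 0))).setReg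
      { s.reg with top := some (some 0), x := 0 }) (by cases k <;> rfl)
    refine (exec_each_step (t := 1) ?_ (.ops_to ?_) h₂).cast ?_ ?_
    · simp [State.popped, h, isVal]
    · simp only [State.popped, h]
      cases k <;> rfl
    · cases k <;> rfl
    · omega

/-- Cancel the counters against each other, keeping the smaller one on `lamTmp`. -/
def cancel : Cmd :=
  each isVal .cntC (.ops [.pop .cntS fun r _ => r, .push .lamTmp fun _ => some 0])

theorem exec_cancel (c e : ℕ) (r : Reg) (lamTmp : List Sym) (out : List Bool) :
    Exec cancel
      ⟨r, [], [], [], [], [], lamTmp, [], [], List.replicate (c + e) (some 0), List.replicate c (some 0), out⟩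
      ⟨{ r with top := none, x := 0 }, [], [], [], [], [], List.replicate c (some 0) ++ lamTmp, [], [],
        List.replicate e (some 0), [], out⟩ (3 * c + 2) := by
  induction c generalizing r lamTmp with
  | zero => exact (exec_each_stop _ rfl).cast (by simp; rfl) (by simp)
  | succ c ih =>
    rw [show c + 1 + e = c + e + 1 by omega]
    refine (exec_each_step (t := 1) rfl (.ops_to (by rfl))
      (ih { r with top := some (some 0), x := 0 } (some 0 :: lamTmp))).cast ?_ ?_
    · simp [List.replicate_succ']
    · omega

/-- Write the answer, given the counters and the final memory. -/
def output : Cmd :=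
  .seq (.ite (fun r => r.orig) (.seq (clear .cntS) (clear .cntC))
  (.ite (fun r => r.found) (.seq (clear .cntC) (.seq (.ops [.pop .cntS fun r _ => r, .emit fun _ => true])
    (emitAll .cntS false)))
  (.seq cancel (.seq (.ops [.pop .cntS fun r o => { r with top := o }])
  (.ite (fun r => r.d == 0)
    (.ite isVal
      (.seq (.ops [.emit fun _ => true]) (.seq (emitAll .cntS false)
        (.seq (.ops [.emit fun _ => true, .pop .lamTmp fun r _ => r]) (emitAll .lamTmp false))))
      (.seq (.ops [.emit fun _ => true]) (emitAll .lamTmp false)))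
    (.ite isVal
      (.seq (.ops [.emit fun _ => true]) (.seq (emitAll .cntS true)
        (.seq (.ops [.pop .lamTmp fun r _ => r]) (emitAll .lamTmp false))))
      (clear .lamTmp)))))))
  (.ops [.load fun _ => Reg.init])

/-- If the original system is inconsistent, N = 0; if only the extended one is, N = 2^(s-1).
Otherwise N = (2^s ± 2^c)/2: for s = c this is 2^c or 0, and for s = c + e with e > 0 it is
2^(c-1)·(2^e ± 1). All of these have simple digit patterns: zeros below 1, 10…01 or 1…1. The output
is a stack, so the most significant digit is emitted first. -/
theorem exec_output {N s c : ℕ} {d : ZMod 2} {found orig : Bool}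
    (hN : 2 * (N : ℤ) = (if orig = true then 0 else 2 ^ s) +
      if found = true then 0 else 2 ^ c * sign d) (ho : orig = true → found = true) (hcs : c ≤ s) :
    Exec output
      ⟨.main d found orig, [], [], [], [], [], [], [], [], List.replicate s (some 0),
        List.replicate c (some 0), []⟩ (.final (encodeNat N)) (10 * s + 20) := by
  cases orig with
  | true =>
    obtain rfl : N = 0 := by simpa [ho rfl] using hN
    exact (Exec.seq (.ite_true rfl (.seq (exec_clear _ rfl) (exec_clear _ rfl)))
      (.ops_to (by rfl))).mono (by omega)
  | false =>
  cases found with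
  | true =>
    simp only [if_true, if_false, add_zero, Bool.false_eq_true] at hN
    norm_cast at hN
    -- For s = 0 the equation would read 2N = 1.
    obtain _ | s := s
    · omega
    obtain rfl : N = 2 ^ s := by rw [pow_succ] at hN; omega
    rw [encodeNat_two_pow]
    refine (Exec.seq (.ite_false rfl (.ite_true rfl (.seq (exec_clear _ rfl) (.seq (.ops_to (by rfl))
      (exec_emitAll false ⟨.main d true false, [], [], [], [], [], [], [], [],
        List.replicate s (some 0), [], [true]⟩ rfl)))))
      (.ops_to (by rfl))).mono (by omega)
  | false =>
    obtain ⟨e, rfl⟩ := Nat.exists_eq_add_of_le hcs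
    simp only [if_false, Bool.false_eq_true] at hN
    have h₁ := exec_cancel c e (.main d false false) [] []
    rw [List.append_nil] at h₁
    rcases eq_zero_or_one d with rfl | rfl
    · simp only [sign, if_true, mul_one] at hN
      norm_cast at hN
      obtain _ | e := e
      · obtain rfl : N = 2 ^ c := by rw [add_zero] at hN; omega
        rw [encodeNat_two_pow]
        exact (Exec.seq (.ite_false rfl (.ite_false rfl (.seq h₁ (.seq (.ops_to (by rfl))
          (.ite_true rfl (.ite_false rfl (.seq (.ops_to (by rfl))
          (exec_emitAll false ⟨.main 0 false false, [], [], [], [], [], List.replicate c (some 0),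
            [], [], [], [], [true]⟩ rfl)))))))) (.ops_to (by rfl))).mono (by omega)
      -- With e > 0 and c = 0 the right-hand side would be odd. From here on `c` and `e` stand for
      -- the original values minus 1.
      · obtain _ | c := c
        · rw [pow_zero, zero_add, pow_succ] at hN
          omega
        have hN' : N = 2 ^ c * (2 ^ e * 2 + 1) := by
          rw [show c + 1 + (e + 1) = c + e + 1 + 1 by ring, pow_succ, pow_succ, pow_add, pow_succ] at hN
          rw [mul_add, ← mul_assoc]
          omega
        rw [hN', encodeNat_two_pow_mul _ (by positivity), mul_comm _ 2, encodeNat_two_mul_add_one,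
          encodeNat_two_pow]
        refine (Exec.seq (.ite_false rfl (.ite_false rfl (.seq h₁ (.seq (.ops_to (by rfl))
          (.ite_true rfl (.ite_true rfl (.seq (.ops_to (by rfl))
          (.seq (exec_emitAll (n := e) false ⟨{ Reg.main 0 false false with top := some (some 0) },
            [], [], [], [], [], List.replicate (c + 1) (some 0),
            [], [], List.replicate e (some 0), [], [true]⟩ rfl)
          (.seq (.ops_to (by rfl))
          (exec_emitAll false ⟨.main 0 false false, [], [], [], [], [], List.replicate c (some 0),
            [], [], [], [], true :: (List.replicate e false ++ [true])⟩ rfl)))))))))) (.ops_to (by rfl))).mono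
          (by omega)
    · simp only [sign, if_neg (one_ne_zero : (1 : ZMod 2) ≠ 0)] at hN
      obtain _ | e := e
      · obtain rfl : N = 0 := by simpa using hN
        exact (Exec.seq (.ite_false rfl (.ite_false rfl (.seq h₁ (.seq (.ops_to (by rfl))
          (.ite_false rfl (.ite_false rfl (exec_clear ⟨{ Reg.main 1 false false with top := none },
            [], [], [], [], [], List.replicate c (some 0), [], [], [], [], []⟩ rfl)))))))
          (.ops_to (by rfl))).mono (by omega)
      -- Again c = 0 is excluded by parity, and `c` and `e` are shifted by 1.
      · obtain _ | c := c
        · rw [pow_zero, zero_add, pow_succ] at hN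
          omega
        have hN' : N = 2 ^ c * (2 ^ (e + 1) - 1) := by
          have h2 : (2 : ℕ) ^ (c + 1 + (e + 1)) = 2 * (2 ^ c * 2 ^ (e + 1)) := by ring
          have h3 : (2 : ℕ) ^ (c + 1) = 2 * 2 ^ c := by ring
          have h4 : 2 * N + 2 ^ (c + 1) = 2 ^ (c + 1 + (e + 1)) := by
            zify
            linarith
          rw [Nat.mul_sub, mul_one]
          omega
        have hpos : 0 < 2 ^ (e + 1) - 1 := by
          have := Nat.one_le_two_pow (n := e)
          rw [pow_succ]
          omega
        rw [hN', encodeNat_two_pow_mul _ hpos, encodeNat_two_pow_sub_one]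
        refine (Exec.seq (.ite_false rfl (.ite_false rfl (.seq h₁ (.seq (.ops_to (by rfl))
          (.ite_false rfl (.ite_true rfl (.seq (.ops_to (by rfl))
          (.seq (exec_emitAll (n := e) true ⟨{ Reg.main 1 false false with top := some (some 0) },
            [], [], [], [], [], List.replicate (c + 1) (some 0),
            [], [], List.replicate e (some 0), [], [true]⟩ rfl)
          (.seq (.ops_to (by rfl))
          (exec_emitAll false ⟨.main 1 false false, [], [], [], [], [], List.replicate c (some 0),
            [], [], [], [], List.replicate e true ++ [true]⟩ rfl)))))))))) (.ops_to ?_)).mono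
          (by omega)
        rw [List.replicate_succ']
        rfl

/-- Evaluate the remaining constant equations. -/
def verdict : Cmd :=
  .seq (.ops [.load fun r => .main r.d false false])
  (each isVal .lin (.ops [.pop .lin fun r o => { r with h := val o }, .pop .lin fun r _ => r,
    .load fun r => { r with
      found := r.found || r.h == 1, orig := r.orig || (r.h == 1 && r.x == 0), h := 0 }]))

theorem exec_verdict_loop {L : List (ZMod 2 × List (ZMod 2))} (hL : ∀ p ∈ L, p.2.length = 1)
    (d : ZMod 2) (found orig : Bool) (t : Option Sym) (x : ZMod 2) (inp cntS cntC : List Sym)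
    (out : List Bool) :
    Exec (each isVal .lin (.ops [.pop .lin fun r o => { r with h := val o }, .pop .lin fun r _ => r,
        .load fun r => { r with
          found := r.found || r.h == 1, orig := r.orig || (r.h == 1 && r.x == 0), h := 0 }]))
      ⟨{ Reg.main d found orig with top := t, x := x }, inp, [], encTagged L, [], [], [], [], [],
        cntS, cntC, out⟩
      ⟨.main d (found || hasPivot L) (orig || hasOrigPivot L), inp, [], [], [], [], [], [], [],
        cntS, cntC, out⟩ (3 * L.length + 2) := by
  induction L generalizing found orig t x with
  | nil => exact (exec_each_stop _ rfl).cast (by simp [hasPivot, hasOrigPivot]; rfl) (by simp)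
  | cons p L ih =>
    obtain ⟨tag, r⟩ := p
    simp only [List.mem_cons, forall_eq_or_imp] at hL
    obtain ⟨h, rfl⟩ := List.length_eq_one_iff.1 hL.1
    rw [encTagged_cons]
    refine (exec_each_step (t := 1) rfl (.ops_to (by rfl)) (ih hL.2 (found || h == 1)
      (orig || (h == 1 && tag == 0)) (some (some tag)) tag)).cast ?_ ?_
    · simp [hasPivot, hasOrigPivot, Bool.or_assoc]
    · simp only [List.length_cons]; omega

theorem exec_verdict {L : List (ZMod 2 × List (ZMod 2))} (hL : ∀ p ∈ L, p.2.length = 1)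
    (d : ZMod 2) (found orig : Bool) (t : Option Sym) (inp cntS cntC : List Sym)
    (out : List Bool) :
    Exec verdict
      ⟨{ Reg.main d found orig with top := t }, inp, [], encTagged L, [], [], [], [], [],
        cntS, cntC, out⟩
      ⟨.main d (hasPivot L) (hasOrigPivot L), inp, [], [], [], [], [], [], [],
        cntS, cntC, out⟩ (3 * L.length + 3) :=
  (Exec.seq (.ops_to (by rfl)) (exec_verdict_loop hL d false false none 0 inp cntS cntC out)).mono
    (by omega)

/-- With no variables left a row is a constant, and a row with head 1 is the contradiction 1 = 0.
Thus the pivot test now detects inconsistency. -/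
theorem linSum_zero {A B : List (List (ZMod 2))} (hA : ∀ r ∈ A, r.length = 1) :
    linSum 0 A = if hasOrigPivot (tagged A B) = true then 0 else 1 := by
  have : Sat A [1] ↔ ¬ hasOrigPivot (tagged A B) = true := by
    simp only [Sat, hasOrigPivot, tagged, List.any_append, List.any_map, Bool.or_eq_true,
      List.any_eq_true, Function.comp, Bool.and_eq_true, beq_iff_eq]
    push Not
    constructor
    · refine fun h => ⟨fun r hr h1 => absurd (h r hr) ?_, fun _ _ _ => one_ne_zero⟩
      obtain ⟨a, rfl⟩ := List.length_eq_one_iff.1 (hA r hr)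
      obtain rfl : a = 1 := h1
      simp
    · intro h r hr
      obtain ⟨a, rfl⟩ := List.length_eq_one_iff.1 (hA r hr)
      rcases eq_zero_or_one a with rfl | rfl
      · simp
      · exact (h.1 _ hr rfl).elim
  simp only [linSum, cubeSum, this, ite_not]

theorem expSum_zero {A B : List (List (ZMod 2))} (hA : ∀ r ∈ A, r.length = 1)
    (hB : ∀ r ∈ B, r.length = 1) (d : ZMod 2) :
    expSum 0 [[d]] (A ++ B) = if hasPivot (tagged A B) = true then 0 else sign d := by
  have : Sat (A ++ B) [1] ↔ ¬ hasPivot (tagged A B) = true := by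
    have key : ∀ r : List (ZMod 2), r.length = 1 → (dot r [1] = 0 ↔ r.headI ≠ 1) := by
      intro r hr
      obtain ⟨a, rfl⟩ := List.length_eq_one_iff.1 hr
      rcases eq_zero_or_one a with rfl | rfl <;> simp
    simp only [Sat, hasPivot, tagged, List.any_append, List.any_map, Bool.or_eq_true,
      List.any_eq_true, Function.comp, beq_iff_eq, List.mem_append, or_imp, forall_and]
    push Not
    exact and_congr (forall₂_congr fun r hr => key r (hA r hr))
      (forall₂_congr fun r hr => key r (hB r hr))
  simp only [expSum, cubeSum, this, ite_not, evalTable]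
  simp

/-! ### Reading the input -/

/-- Copy a row from the input to `lamTmp`. -/
def readRow : Cmd := each isVal .inp (.ops [.push .lamTmp fun r => some r.x])

theorem exec_readRow (u : List (ZMod 2)) (r : Reg)
    (rest tri lin lam piv lamTmp pivTmp aux cntS cntC : List Sym) (out : List Bool) :
    Exec readRow
      ⟨r, u.map some ++ none :: rest, tri, lin, lam, piv, lamTmp, pivTmp, aux, cntS, cntC, out⟩
      ⟨{ r with top := some none, x := 0 }, rest, tri, lin, lam, piv,
        (u.map some).reverse ++ lamTmp, pivTmp, aux, cntS, cntC, out⟩ (3 * u.length + 2) := by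
  induction u generalizing r lamTmp with
  | nil => exact (exec_each_stop _ rfl).cast rfl (by simp)
  | cons x u ih =>
    refine (exec_each_step (t := 1) rfl (.ops_to (by rfl))
      (ih { r with top := some (some x), x := x } (some x :: lamTmp))).cast ?_ ?_
    · simp
    · simp only [List.length_cons]; omega

/-- Copy a row from the input to `aux`. -/
def copyRow : Cmd := each isVal .inp (.ops [.push .aux fun r => some r.x])

theorem exec_copyRow (u : List (ZMod 2)) (r : Reg)
    (rest tri lin lam piv lamTmp pivTmp aux cntS cntC : List Sym) (out : List Bool) :
    Exec copyRow
      ⟨r, u.map some ++ none :: rest, tri, lin, lam, piv, lamTmp, pivTmp, aux, cntS, cntC, out⟩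
      ⟨{ r with top := some none, x := 0 }, rest, tri, lin, lam, piv,
        lamTmp, pivTmp, (u.map some).reverse ++ aux, cntS, cntC, out⟩ (3 * u.length + 2) := by
  induction u generalizing r aux with
  | nil => exact (exec_each_stop _ rfl).cast rfl (by simp)
  | cons x u ih =>
    refine (exec_each_step (t := 1) rfl (.ops_to (by rfl))
      (ih { r with top := some (some x), x := x } (some x :: aux))).cast ?_ ?_
    · simp
    · simp only [List.length_cons]; omega

/-- Copy a row from the input to `aux`, dropping as many entries as the counter `piv` says. -/
def dropRow : Cmd :=
  each isVal .inp (.seq (.ops [.pop .piv fun r o => { r with top := o }])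
    (.ite isVal (.ops [.push .pivTmp fun _ => some 0]) (.ops [.push .aux fun r => some r.x])))

theorem exec_dropRow (u : List (ZMod 2)) (i : ℕ) (r : Reg)
    (rest tri lin lam lamTmp pivTmp aux cntS cntC : List Sym) (out : List Bool) :
    Exec dropRow
      ⟨r, u.map some ++ none :: rest, tri, lin, lam, List.replicate i (some 0), lamTmp, pivTmp, aux,
        cntS, cntC, out⟩
      ⟨{ r with top := some none, x := 0 }, rest, tri, lin, lam,
        List.replicate (i - u.length) (some 0), lamTmp,
        List.replicate (min i u.length) (some 0) ++ pivTmp,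
        ((u.drop i).map some).reverse ++ aux, cntS, cntC, out⟩ (5 * u.length + 2) := by
  induction u generalizing i r pivTmp aux with
  | nil => exact (exec_each_stop _ rfl).cast (by simp; rfl) (by simp)
  | cons x u ih =>
    obtain _ | i := i
    · refine (exec_each_step rfl (.seq (.ops_to (by rfl)) (.ite_false rfl (.ops_to (by rfl))))
        (ih 0 { r with top := none, x := x } pivTmp (some x :: aux))).cast ?_ ?_
      · simp
      · simp only [List.length_cons]; omega
    · refine (exec_each_step rfl (.seq (.ops_to (by rfl)) (.ite_true rfl (.ops_to (by rfl))))
        (ih i { r with top := some (some 0), x := x } (some 0 :: pivTmp) aux)).cast ?_ ?_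
      · simp [List.replicate_succ', Nat.add_min_add_right]
      · simp only [List.length_cons]; omega

/-- The upper triangular part of a table, the first row starting at column `i`, followed by the
column `l`. -/
def triRows : ℕ → List (ZMod 2) → List (List (ZMod 2)) → List (List (ZMod 2))
  | i, a :: l, q :: Q => (q.drop i ++ [a]) :: triRows (i + 1) l Q
  | _, _, _ => []

/-- Build the triangular table. -/
def readTable : Cmd :=
  each isVal .lam (.seq (.ops [.load fun r => { r with a := r.x }])
    (.seq dropRow (.seq (move .pivTmp .piv)
    (.ops [.push .piv fun _ => some 0, .push .aux fun r => some r.a, .push .aux fun _ => none,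
      .load fun r => { r with a := 0 }]))))

/-- `piv` is a unary row counter: row `i` loses its first `i` entries, which repeat coefficients by
symmetry, and receives the linear coefficient as last entry, to be paired with the coordinate 1. -/
theorem exec_readTable {n : ℕ} {l : List (ZMod 2)} {Q : List (List (ZMod 2))}
    (hQ : ∀ q ∈ Q, q.length = n) (hl : l.length = Q.length) {i : ℕ} (hi : i + l.length ≤ n)
    (d : ZMod 2) (E : List (List (ZMod 2))) (aux : List Sym) :
    Exec readTable
      ⟨.main d false false, encTable (Q ++ E), [], [], l.map some, List.replicate i (some 0), [], [],
        aux, [], [], []⟩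
      ⟨.main d false false, encTable E, [], [], [], List.replicate (i + l.length) (some 0), [], [],
        (encTable (triRows i l Q)).reverse ++ aux, [], [], []⟩ (l.length * (8 * n + 8) + 2) := by
  induction l generalizing Q i aux with
  | nil =>
    obtain rfl : Q = [] := by simpa using hl.symm
    exact (exec_each_stop _ rfl).cast (by simp [triRows, encTable]; rfl) (by simp)
  | cons a l ih =>
    obtain _ | ⟨q, Q⟩ := Q
    · simp at hl
    simp only [List.length_cons, Nat.add_right_cancel_iff] at hl hi
    simp only [List.mem_cons, forall_eq_or_imp] at hQ
    have h₁ := exec_dropRow q i ⟨some (some a), a, 0, 0, a, 0, d, 0, 0, false, false⟩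
      (encTable (Q ++ E)) [] [] (l.map some) [] [] aux [] [] []
    rw [hQ.1, Nat.sub_eq_zero_of_le (by omega), min_eq_left (by omega), List.append_nil] at h₁
    have h₂ := exec_move (k := .pivTmp) (k' := .piv) (by decide)
      ⟨⟨some none, 0, 0, 0, a, 0, d, 0, 0, false, false⟩, encTable (Q ++ E), [], [], l.map some, [], [],
        List.replicate i (some 0), ((q.drop i).map some).reverse ++ aux, [], [], []⟩
    simp only [State.get, State.set, State.setReg, List.reverse_replicate, List.append_nil,
      List.length_replicate] at h₂
    rw [List.cons_append, encTable_cons]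
    refine (exec_each_step rfl (.seq (.ops_to (by rfl)) (.seq h₁ (.seq h₂ (.ops_to (by rfl)))))
      (ih (i := i + 1) hQ.2 hl (by omega)
      (none :: some a :: (((q.drop i).map some).reverse ++ aux)))).cast ?_ ?_
    · simp [triRows, encTable_cons]
      omega
    · simp only [List.length_cons]
      ring_nf; omega

/-- Copy the linear polynomials to `aux`, with tag `0`. -/
def readLinear : Cmd :=
  each isVal .inp (.seq (.ops [.push .aux fun _ => some 0, .push .aux fun r => some r.x])
    (.seq copyRow (.ops [.push .aux fun _ => none])))

theorem exec_readLinear {n : ℕ} {E : List (List (ZMod 2))} (hE : ∀ r ∈ E, r.length = n + 1)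
    (d : ZMod 2) (t : Option Sym) (x : ZMod 2) (tri aux : List Sym) :
    Exec readLinear
      ⟨{ Reg.main d false false with top := t, x := x }, encTable E, tri, [], [], [], [], [],
        aux, [], [], []⟩
      ⟨.main d false false, [], tri, [], [], [], [], [],
        (encTagged (tagged E [])).reverse ++ aux, [], [], []⟩ (E.length * (3 * n + 6) + 2) := by
  induction E generalizing t x aux with
  | nil => exact (exec_each_stop _ rfl).cast rfl (by simp)
  | cons r E ih =>
    simp only [List.mem_cons, forall_eq_or_imp] at hE
    obtain _ | ⟨h, r⟩ := r
    · simp at hE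
    have hr : r.length = n := by simpa using hE.1
    have h₁ := exec_copyRow r { Reg.main d false false with top := some (some h), x := h }
      (encTable E) tri [] [] [] [] [] (some h :: some 0 :: aux) [] [] []
    rw [encTable_cons]
    refine (exec_each_step rfl (.seq (.ops_to (by rfl)) (.seq h₁ (.ops_to (by rfl))))
      (ih hE.2 (some none) 0 (none :: ((r.map some).reverse ++ some h :: some 0 :: aux)))).cast ?_ ?_
    · simp [tagged, encTagged_cons]
    · simp only [List.length_cons, hr]
      ring_nf; omega

/-- Read the input and build the two tables. -/
def readInput : Cmd :=
  .seq readRow (.seq (.ops [.pop .lamTmp fun r o => { r with d := val o }])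
  (.seq (move .lamTmp .lam) (.seq readTable (.seq (clear .piv)
  (.seq (.ops [.push .aux fun r => some r.d, .push .aux fun _ => none])
  (.seq (move .aux .tri) (.seq readLinear (move .aux .lin))))))))

/-- The row `[c]` belongs to the extra coordinate 1 and holds the constant term. -/
theorem isTri_triRows {n : ℕ} {l : List (ZMod 2)} {Q : List (List (ZMod 2))}
    (hQ : ∀ q ∈ Q, q.length = n) (hl : l.length = Q.length) {i : ℕ} (hi : i + l.length = n)
    (c : ZMod 2) : IsTri (l.length + 1) (triRows i l Q ++ [[c]]) := by
  induction l generalizing Q i with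
  | nil => exact ⟨[c], [], by simp [triRows], rfl, rfl⟩
  | cons a l ih =>
    obtain _ | ⟨q, Q⟩ := Q
    · simp at hl
    simp only [List.length_cons, Nat.add_right_cancel_iff] at hl hi
    simp only [List.mem_cons, forall_eq_or_imp] at hQ
    refine ⟨_, _, rfl, ?_, ih hQ.2 hl (by omega)⟩
    simp [hQ.1]
    omega

theorem exec_readInput {n : ℕ} {l : List (ZMod 2)} {c : ZMod 2} {Q E : List (List (ZMod 2))}
    (hl : l.length = n) (hQ : ∀ q ∈ Q, q.length = n) (hQl : Q.length = n)
    (hE : ∀ r ∈ E, r.length = n + 1) {K : ℕ} (hK : n + E.length ≤ K) :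
    Exec readInput (.start (encTable ((l ++ [c]) :: (Q ++ E))))
      ⟨.main c false false, [], encTable (triRows 0 l Q ++ [[c]]), encTagged (tagged E []),
        [], [], [], [], [], [], [], []⟩ (100 * (K + 2) ^ 2) := by
  have h₁ := exec_readRow (l ++ [c]) Reg.init (encTable (Q ++ E)) [] [] [] [] [] [] [] [] [] []
  have e₁ : ((l ++ [c]).map some).reverse ++ [] = some c :: (l.map some).reverse := by simp
  rw [e₁] at h₁
  have h₂ := exec_move (k := .lamTmp) (k' := .lam) (by decide)
    ⟨{ Reg.main c false false with top := some none }, encTable (Q ++ E), [], [], [], [],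
      (l.map some).reverse, [], [], [], [], []⟩
  have h₃ := exec_readTable (i := 0) hQ (by omega) (by omega) c E [] (l := l)
  have h₄ := exec_clear (k := .piv) (n := n) ⟨.main c false false, encTable E, [], [], [],
    List.replicate n (some 0), [], [], (encTable (triRows 0 l Q)).reverse ++ [], [], [], []⟩ rfl
  have h₅ := exec_move (k := .aux) (k' := .tri) (by decide)
    ⟨.main c false false, encTable E, [], [], [], [], [], [],
      none :: some c :: ((encTable (triRows 0 l Q)).reverse ++ []), [], [], []⟩
  have h₆ := exec_readLinear hE c none 0 (encTable (triRows 0 l Q ++ [[c]])) []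
  have h₇ := exec_move (k := .aux) (k' := .lin) (by decide)
    ⟨.main c false false, [], encTable (triRows 0 l Q ++ [[c]]), [], [], [], [], [],
      (encTagged (tagged E [])).reverse ++ [], [], [], []⟩
  have l₁ := length_encTable (isTri_triRows hQ (by omega) (show 0 + l.length = n by omega) c)
  have l₂ := length_encTagged_le (tagged E []) (n := n + 1) (by simpa [tagged] using hE)
  have e₂ : encTable (triRows 0 l Q ++ [[c]]) = encTable (triRows 0 l Q) ++ [some c, none] := by
    simp [encTable, encRow]
  simp only [State.get, State.set, State.setReg, List.append_nil,
    List.reverse_cons, List.reverse_reverse, List.length_append, List.length_reverse, zero_add,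
    List.append_assoc, List.singleton_append, ← e₂, hl] at h₁ h₂ h₃ h₄ h₅ h₆ h₇
  rw [encTable_cons]
  refine (Exec.seq h₁ (.seq (.ops_to (by rfl)) (.seq h₂ (.seq h₃ (.seq h₄ (.seq (.ops_to (by rfl))
    (.seq h₅ (.seq h₆ h₇)))))))).mono ?_
  rw [e₂] at l₁
  have l₃ : (tagged E []).length = E.length := by simp [tagged]
  rw [l₂, l₃]
  simp only [List.length_append, List.length_cons, List.length_nil, List.length_reverse,
    List.length_map, hl] at l₁ ⊢
  have b₁ : E.length * n ≤ K * K := Nat.mul_le_mul (by omega) (by omega)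
  have b₂ : n * n ≤ K * K := Nat.mul_le_mul (by omega) (by omega)
  nlinarith

/-! ### Polynomials and tables -/

theorem dot_ofFn {n : ℕ} (a x : Fin n → ZMod 2) (c : ZMod 2) :
    dot (List.ofFn a ++ [c]) (List.ofFn x ++ [1]) = c + ∑ i, a i * x i := by
  induction n with
  | zero => simp
  | succ n ih =>
    simp only [List.ofFn_succ, List.cons_append, dot_cons, ih, Fin.sum_univ_succ]
    ring

/-- Starting one column further amounts to deleting the first column, which lets an induction remove
the first variable. -/
theorem triRows_succ (l : List (ZMod 2)) (Q : List (List (ZMod 2))) (i : ℕ) :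
    triRows (i + 1) l Q = triRows i l (Q.map List.tail) := by
  induction l generalizing Q i with
  | nil => simp [triRows]
  | cons a l ih =>
    cases Q with
    | nil => simp [triRows]
    | cons q Q => simp [triRows, ih]

theorem evalTable_triRows {n : ℕ} (C : Fin n → Fin n → ZMod 2) (l x : Fin n → ZMod 2) (c : ZMod 2) :
    evalTable (triRows 0 (List.ofFn l) (List.ofFn fun i => List.ofFn (C i)) ++ [[c]])
        (List.ofFn x ++ [1]) =
      c + ∑ i, l i * x i + ∑ i, ∑ j, if i ≤ j then C i j * (x i * x j) else 0 := by
  induction n with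
  | zero => simp [triRows, evalTable]
  | succ n ih =>
    have e : ((List.ofFn fun i : Fin n => List.ofFn (C i.succ)).map List.tail) =
        List.ofFn fun i : Fin n => List.ofFn fun j : Fin n => C i.succ j.succ := by
      rw [List.map_ofFn]
      simp [Function.comp_def, List.ofFn_succ]
    rw [List.ofFn_succ (f := l), List.ofFn_succ (f := fun i => List.ofFn (C i)),
      List.ofFn_succ (f := x), triRows, triRows_succ, e]
    simp only [List.cons_append, evalTable, ih, List.drop_zero, List.ofFn_succ (f := C 0),
      List.headI_cons, List.tail_cons, dot_ofFn, Fin.sum_univ_succ, Fin.zero_le, if_true,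
      Fin.succ_le_succ_iff, Fin.succ_ne_zero, if_false, zero_add, Fin.le_zero_iff]
    have h := mul_self_eq (x 0)
    have e₂ : ∑ j : Fin n, C 0 j.succ * (x 0 * x j.succ) = x 0 * ∑ j : Fin n, C 0 j.succ * x j.succ := by
      rw [Finset.mul_sum]
      exact Finset.sum_congr rfl fun j _ => by ring
    rw [e₂]
    linear_combination (-(C 0 0)) * h

open MvPolynomial in
/-- A polynomial of degree at most two over the field with two elements, as a function of the
coefficients written in the input. -/
theorem eval_quadratic {n : ℕ} (q : MvPolynomial (Fin n) (ZMod 2)) (hq : q.totalDegree ≤ 2)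
    (x : Fin n → ZMod 2) :
    eval x q = q.coeff 0 + ∑ i, q.coeff (Finsupp.single i 1) * x i +
      ∑ i, ∑ j, if i ≤ j then
        q.coeff (Finsupp.single i 1 + Finsupp.single j 1) * (x i * x j) else 0 := by
  -- The right-hand side is linear in the polynomial, so it suffices to compare both sides on
  -- monomials of degree at most 2.
  let Φ : MvPolynomial (Fin n) (ZMod 2) →ₗ[ZMod 2] ZMod 2 :=
    lcoeff (R := ZMod 2) 0 + ∑ i, x i • lcoeff (R := ZMod 2) (Finsupp.single i 1) +
      ∑ i, ∑ j, (if i ≤ j then x i * x j else 0) •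
        lcoeff (R := ZMod 2) (Finsupp.single i 1 + Finsupp.single j 1)
  have hΦ : ∀ p, Φ p = p.coeff 0 + ∑ i, p.coeff (Finsupp.single i 1) * x i +
      ∑ i, ∑ j, if i ≤ j then
        p.coeff (Finsupp.single i 1 + Finsupp.single j 1) * (x i * x j) else 0 := by
    intro p
    simp [Φ, LinearMap.sum_apply, mul_comm]
    refine Finset.sum_congr rfl fun i _ => Finset.sum_congr rfl fun j _ => ?_
    split_ifs <;> simp
  have deg1 : ∀ i : Fin n, (Finsupp.single i 1 : Fin n →₀ ℕ).degree = 1 := by simp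
  have deg2 : ∀ i j : Fin n, (Finsupp.single i 1 + Finsupp.single j 1 : Fin n →₀ ℕ).degree = 2 := by
    simp
  have ne_of_deg : ∀ {m m' : Fin n →₀ ℕ}, m.degree ≠ m'.degree → m ≠ m' := fun h h' => h (h' ▸ rfl)
  have hmono : ∀ (m : Fin n →₀ ℕ) (a : ZMod 2), m.degree ≤ 2 →
      eval x (monomial m a) = Φ (monomial m a) := by
    intro m a hm
    rw [hΦ]
    simp only [coeff_monomial, eval_monomial]
    rcases QuadLinSystem.eq_zero_or_single_add m hm with rfl | ⟨i, m', rfl, hm'⟩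
    · have h1 : ∀ i : Fin n, (0 : Fin n →₀ ℕ) ≠ Finsupp.single i 1 :=
        fun i => ne_of_deg (by simp)
      have h2 : ∀ i j : Fin n, (0 : Fin n →₀ ℕ) ≠ Finsupp.single i 1 + Finsupp.single j 1 :=
        fun i j => ne_of_deg (by simp)
      simp [h1, h2]
    · rcases QuadLinSystem.eq_zero_or_single_add m' hm' with rfl | ⟨j, m'', rfl, hm''⟩
      · have h0 : (Finsupp.single i 1 : Fin n →₀ ℕ) ≠ 0 := ne_of_deg (by simp)
        have h2 : ∀ i' j : Fin n, (Finsupp.single i 1 : Fin n →₀ ℕ) ≠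
            Finsupp.single i' 1 + Finsupp.single j 1 := fun i' j => ne_of_deg (by simp)
        simp [h2, Finsupp.single_left_inj]
      · obtain rfl : m'' = 0 := by simpa [Finsupp.degree_eq_zero_iff] using hm''
        rw [add_zero]
        clear hm hm' hm''
        wlog hij : i ≤ j generalizing i j
        · rw [add_comm (Finsupp.single i 1)]
          exact this j i (le_of_not_ge hij)
        have h0 : (Finsupp.single i 1 + Finsupp.single j 1 : Fin n →₀ ℕ) ≠ 0 := ne_of_deg (by simp)
        have h1 : ∀ i' : Fin n, (Finsupp.single i 1 + Finsupp.single j 1 : Fin n →₀ ℕ) ≠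
            Finsupp.single i' 1 := fun i' => ne_of_deg (by simp)
        -- A monomial of degree 2 determines only an unordered pair; ordering both pairs makes
        -- exactly one term of the double sum survive.
        have h2 : ∀ i' j' : Fin n, i' ≤ j' → ((Finsupp.single i 1 + Finsupp.single j 1 : Fin n →₀ ℕ) =
            Finsupp.single i' 1 + Finsupp.single j' 1 ↔ i = i' ∧ j = j') := by
          intro i' j' hij'
          refine ⟨fun h => ?_, by rintro ⟨rfl, rfl⟩; rfl⟩
          have e := fun k => DFunLike.congr_fun h k
          simp only [Finsupp.add_apply, Finsupp.single_apply] at e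
          have e₁ := e i
          have e₂ := e j
          have e₃ := e i'
          have e₄ := e j'
          grind
        simp only [h0, h1, if_false, zero_mul, Finset.sum_const_zero, zero_add]
        rw [Finset.sum_eq_single i, Finset.sum_eq_single j]
        · rw [if_pos hij, if_pos rfl, Finsupp.prod_add_index' (by simp) (fun _ _ _ => pow_add _ _ _)]
          simp
        · intro j' _ hj'
          split_ifs with h3 h4
          · exact absurd ((h2 i j' h3).1 h4).2.symm hj'
          · simp
          · rfl
        · simp
        · intro i' _ hi'
          refine Finset.sum_eq_zero fun j' _ => ?_
          split_ifs with h3 h4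
          · exact absurd ((h2 i' j' h3).1 h4).1.symm hi'
          · simp
          · rfl
        · simp
  rw [← hΦ]
  conv_lhs => rw [q.as_sum]
  conv_rhs => rw [q.as_sum]
  rw [map_sum, map_sum]
  refine Finset.sum_congr rfl fun m hm => hmono m _ ?_
  by_contra h
  exact (mem_support_iff.1 hm) (QuadLinSystem.coeff_eq_zero_of_degree q hq m h)

theorem eval_linear {n : ℕ} (p : MvPolynomial (Fin n) (ZMod 2)) (hp : p.totalDegree ≤ 1)
    (x : Fin n → ZMod 2) :
    MvPolynomial.eval x p = p.coeff 0 + ∑ i, p.coeff (Finsupp.single i 1) * x i := by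
  have h : ∀ i j : Fin n, p.coeff (Finsupp.single i 1 + Finsupp.single j 1) = 0 := fun i j =>
    QuadLinSystem.coeff_eq_zero_of_degree p hp _ (by simp)
  simp [eval_quadratic p (hp.trans one_le_two), h]

theorem cubeSum_eq_sum (n : ℕ) (f : List (ZMod 2) → ℤ) :
    cubeSum n f = ∑ x : Fin n → ZMod 2, f (List.ofFn x ++ [1]) := by
  induction n generalizing f with
  | zero => simp [cubeSum]
  | succ n ih =>
    rw [cubeSum, ih, ih, ← (Fin.consEquiv fun _ : Fin (n + 1) => ZMod 2).sum_comp,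
      Fintype.sum_prod_type]
    have h2 : (Finset.univ : Finset (ZMod 2)) = {0, 1} := rfl
    rw [h2, Finset.sum_pair zero_ne_one]
    simp [Fin.consEquiv, List.ofFn_succ]

/-! ### The counting program -/

/-- The coefficients of the linear part of a polynomial. -/
noncomputable def linCoeffs {n : ℕ} (p : MvPolynomial (Fin n) (ZMod 2)) : List (ZMod 2) :=
  List.ofFn fun i => p.coeff (Finsupp.single i 1)

/-- The rows of the linear polynomials of an instance. -/
noncomputable def linRows (I : QuadLinSystem) : List (List (ZMod 2)) :=
  List.ofFn fun i => QuadLinSystem.affineRow (I.ℓ i)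

/-- The triangular table of the quadratic polynomial of an instance. -/
noncomputable def quadTable (I : QuadLinSystem) : List (List (ZMod 2)) :=
  triRows 0 (linCoeffs I.q) (List.ofFn fun i => QuadLinSystem.quadRow I.q i) ++ [[I.q.coeff 0]]

theorem evalTable_quadTable (I : QuadLinSystem) (x : Fin I.n → ZMod 2) :
    evalTable (quadTable I) (List.ofFn x ++ [1]) = MvPolynomial.eval x I.q := by
  rw [eval_quadratic _ I.q_quadratic]
  exact evalTable_triRows _ _ _ _

theorem sat_linRows (I : QuadLinSystem) (x : Fin I.n → ZMod 2) :
    Sat (linRows I) (List.ofFn x ++ [1]) ↔ ∀ i, MvPolynomial.eval x (I.ℓ i) = 0 := by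
  simp only [Sat, linRows, List.forall_mem_ofFn_iff]
  refine forall_congr' fun i => ?_
  rw [eval_linear _ (I.ℓ_linear i), QuadLinSystem.affineRow, dot_ofFn]

/-- Termwise this is 1 + (-1)^q(x) = 2·[q(x) = 0] on the solutions of the linear system. -/
theorem two_mul_numSolutions (I : QuadLinSystem) :
    2 * (I.numSolutions : ℤ) = linSum I.n (linRows I) + expSum I.n (quadTable I) (linRows I) := by
  classical
  rw [linSum, expSum, cubeSum_eq_sum, cubeSum_eq_sum, ← Finset.sum_add_distrib,
    QuadLinSystem.numSolutions, Nat.card_eq_fintype_card, Fintype.card_subtype,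
    Finset.card_filter, Nat.cast_sum, Finset.mul_sum]
  refine Finset.sum_congr rfl fun x _ => ?_
  simp only [sat_linRows, evalTable_quadTable, sign]
  by_cases h : ∀ i, MvPolynomial.eval x (I.ℓ i) = 0 <;>
    by_cases h' : MvPolynomial.eval x I.q = 0 <;> simp [h, h']

/-- The program that counts the solutions. -/
def countProgram : Cmd :=
  .seq readInput (.seq (.ops [.pop .tri fun r o => { r with d := val o }])
  (.seq (each isVal .tri elimStep) (.seq verdict output)))

theorem exec_countProgram (I : QuadLinSystem) :
    Exec countProgram (.start I.encode) (.final (encodeNat I.numSolutions))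
      (200 * (I.encode.length + 2) ^ 3) := by
  set Q := List.ofFn fun i => QuadLinSystem.quadRow I.q i with hQdef
  have hl : (linCoeffs I.q).length = I.n := by simp [linCoeffs]
  have hQ : ∀ q ∈ Q, q.length = I.n := by
    simp [hQdef, QuadLinSystem.quadRow]
  have hQl : Q.length = I.n := by simp [hQdef]
  have hE : ∀ r ∈ linRows I, r.length = I.n + 1 := by
    simp [linRows, QuadLinSystem.affineRow]
  have henc : I.encode = encTable ((linCoeffs I.q ++ [I.q.coeff 0]) :: (Q ++ linRows I)) := rfl
  obtain ⟨K, hK⟩ : ∃ K, K = I.n + (linRows I).length := ⟨_, rfl⟩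
  have hKlen : K ≤ I.encode.length := by
    -- Each row contributes at least its separator, and the first row of the input alone has more
    -- than `I.n` symbols.
    have h : (linRows I).length ≤ (encTable (linRows I)).length := by
      generalize linRows I = R
      induction R with
      | nil => simp
      | cons r R ih =>
        rw [encTable_cons]
        simp only [List.length_cons, List.length_append]
        omega
    rw [henc, encTable_cons, hK]
    simp only [encTable, List.flatMap_append, List.length_append, List.length_map, hl,
      List.length_cons] at h ⊢
    omega
  have h₁ := exec_readInput (c := I.q.coeff 0) hl hQ hQl hE hK.ge
  have hT : IsTri (I.n + 1) (quadTable I) := by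
    have := isTri_triRows hQ (hl.trans hQl.symm) (show 0 + (linCoeffs I.q).length = I.n by omega)
      (I.q.coeff 0)
    rwa [hl] at this
  rw [← henc] at h₁
  change Exec readInput _ ⟨_, _, encTable (quadTable I), _, _, _, _, _, _, _, _, _⟩ _ at h₁
  have hN := two_mul_numSolutions I
  generalize quadTable I = T at *
  obtain ⟨w, T', rfl, hw, hT'⟩ := id hT
  obtain _ | ⟨d, w⟩ := w
  · simp at hw
  obtain ⟨s, c, d', f, o, A, B, h₂, hAB, hA, hB, hlin, hexp, hs, hc⟩ := exec_elim hT hE (B := [])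
    (by simp) (K := K) (by simp [hK]) 0 0 false false [] []
  rw [List.append_nil] at hexp
  rw [hlin, hexp, linSum_zero hA (B := B), expSum_zero hA hB, mul_ite, mul_ite, mul_zero, mul_zero,
    mul_one] at hN
  have hL : ∀ p ∈ tagged A B, p.2.length = 1 := by
    simp only [tagged, List.mem_append, List.mem_map]
    rintro p (⟨r, h, rfl⟩ | ⟨r, h, rfl⟩)
    exacts [hA r h, hB r h]
  have h₃ := exec_verdict hL d' f o (some none) [] (List.replicate (s + 0) (some 0))
    (List.replicate (c + 0) (some 0)) []
  have h₄ := exec_output hN hasPivot_of_hasOrigPivot hc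
  rw [encTable_cons] at h₁
  refine (Exec.seq h₁ (.seq (.ops_to (by rfl)) (.seq h₂ (.seq h₃ h₄)))).mono ?_
  have hlen : (tagged A B).length ≤ K := by simpa [tagged] using hAB
  have hn : I.n ≤ K := by omega
  -- At most `K` rounds of quadratic cost give the cubic bound.
  calc _ ≤ 100 * (K + 2) ^ 2 + (1 + (K * (100 * (K + 2) ^ 2 + 2) + 2 + (3 * K + 3 + (10 * K + 20)))) := by
        gcongr
        omega
    _ ≤ 200 * (K + 2) ^ 3 := by nlinarith [Nat.zero_le (K ^ 3), Nat.zero_le (K ^ 2)]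
    _ ≤ _ := by gcongr

end StackMachine

/-- Counting the common zeros of one quadratic and any number of linear polynomials over GF(2)
can be done by a Turing machine in time polynomial in the length of the input word; the output
is the number of solutions, in binary. -/
theorem lemma3p3 :
    Nonempty (Turing.TM2ComputableInPolyTime
      QuadLinSystem.encode Computability.encodeNat QuadLinSystem.numSolutions) := by
  refine StackMachine.computableInPolyTime _ _ StackMachine.countProgram
    (200 * (Polynomial.X + 2) ^ 3) fun I => ?_
  have h : (200 * (Polynomial.X + 2) ^ 3 : Polynomial ℕ).eval I.encode.length =
      200 * (I.encode.length + 2) ^ 3 := by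
    simp
  rw [h]
  exact StackMachine.exec_countProgram I
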